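/- **Notation.** Let $n\ge 0$, let $a_1,\dots,a_n\ge 0$ with $A:=\sum_{j=1}^n a_j<1/12$, let $v=(v_1,\dots,v_n)\in\{a,-a\}$ and $r\in(2A,1-2A)$, $r\ne 1/2$. For $k\in\mathbb{N}$ with binary digits $k_0,k_1,\dots$ (least significant first) put $v_{i_1,i_2}^{[k]}:=\sum_{j=i_1+1}^{i_2}(-1)^{k_{j-1}}v_j$ and $v_i^{[k]}:=v_{0,i}^{[k]}$. **Algorithm.** In a minimum-cost flow network with finitely many arcs and possibly infinite capacities, a basic feasible solution is a spanning tree $T$ (the basis) with a feasible flow that is zero or equal to the capacity on every arc outside $T$. The reduced cost of a residual non-tree arc is the cost of sending one unit of flow in its direction around the cycle it closes with $T$. In each iteration of the Network Simplex Algorithm (Dantzig's rule) a residual non-tree arc of minimum reduced cost, if this is negative, enters the basis, as much flow as possible is sent around the cycle, and an arc of the cycle that becomes tight leaves the basis. The algorithm terminates when no residual non-tree arc has negative reduced cost. **Gadget.** $S_0^{v,r}$ consists of the nodes $s_0,t_0$ and the arc $(s_0,t_0)$ of cost $0$ and capacity $1$. $S_i^{v,r}$ arises from $S_{i-1}^{v,r}$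 by adding nodes $s_i,t_i$ and four arcs of capacity $3\cdot 2^{i-1}$: $(s_i,s_{i-1})$ and $(t_{i-1},t_i)$ of cost $\frac12 v_i$, $(s_i,t_{i-1})$ of cost $2^{i-1}-r-\frac12v_i$, and $(s_{i-1},t_i)$ of cost $2^{i-1}-(1-r)-\frac12v_i$. Let $0\le i\le n$ and let $S_i^{v,r}$ be part of a larger network $G$ whose remaining arcs touch $S_i^{v,r}$ only at $s_i$ and $t_i$; among the nodes of $S_i^{v,r}$ other than $s_i,t_i$, $t_0$ has supply $1$, $s_0$ has demand $1$, and all others have supply $0$. In the initial basic feasible solution of $G$ the arcs of the gadget that are in the basis are exactly those of the paths $s_i,s_{i-1},\dots,s_0$ and $t_0,t_1,\dots,t_i$; these carry flow $1$ and all other arcs of the gadget carry flow $0$. **Statement.** Consider an execution of the Network Simplex Algorithm on $G$ from this solution (with any tie-breaking), or any finite initial part of one. Say that an iteration routes flow through the gadget if its cycle contains an arc of the gadget. Assume that before every iteration that routes flow through the gadget there is a tree-path from $t_i$ to $s_i$ in the residual network of $G$ that has cost smaller than $-2^{i+1}$ and capacity greater than $1$. Then in each of the iterations that route flow through the gadget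 exactly one unit of flow is routed from $s_i$ to $t_i$ along arcs of $S_i^{v,r}$ (the rest of the cycle being a tree-path from $t_i$ to $s_i$ outside the gadget). There are at most $3\cdot 2^i-2$ such iterations; if the algorithm has terminated, there are exactly $3\cdot2^i-2$, provided that, should there be fewer than $3\cdot 2^i-2$, such a tree-path also exists on termination. Moreover, numbering these iterations $j=0,1,2,\dots$ in order of occurrence, the following holds for all of them that occur: 1. In iteration $j=3k$, $k=0,\dots,2^i-1$, the arc $(s_0,t_0)$ enters the basis carrying flow $k \bmod 2$ and leaves it in the same iteration carrying flow $(k+1)\bmod 2$. The cost incurred by the arcs of $S_i^{v,r}$ is $k+v_i^{[k]}$. 2. For each $k=0,\dots,2^i-2$ there is $i'\in\{1,\dots,i\}$ such that in iterations $3k+1$ and $3k+2$ the cost incurred by the arcs of $S_i^{v,r}$ is $k+\min(r,1-r)+v_{i',i}^{[k]}$ and $k+\max(r,1-r)+v_{i',i}^{[k]}$, respectively. In one of these two iterations one of the arcs $(s_{i'},s_{i'-1}),(s_{i'-1},t_{i'})$ enters the basis and the other one leaves it; in the other iteration one of the arcs $(s_{i'},t_{i'-1}),(t_{i'-1},t_{i'})$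 enters the basis and the other one leaves it. -/

import Mathlib

/-! ### Minimum-cost flow networks, spanning-tree solutions, and the Network Simplex Algorithm -/

/-- A minimum-cost flow network with node type `V` and arc type `E` (parallel arcs are allowed);
capacities may be infinite and demands are negative supplies. -/
structure Network (V E : Type*) where
  src : E → V
  tgt : E → V
  cost : E → ℝ
  cap : E → WithTop ℝ
  supply : V → ℝ

namespace Network

variable {V E : Type*} (G : Network V E)

/-- A dart `(e, true)` is the arc `e` used forwards, `(e, false)` is the arc `e` used backwards.
This is the node at which a dart starts. -/
def tail : E × Bool → V
  | (e, true) => G.src e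
  | (e, false) => G.tgt e

/-- The node at which a dart ends. -/
def head : E × Bool → V
  | (e, true) => G.tgt e
  | (e, false) => G.src e

/-- The cost of sending one unit of flow along a dart. -/
def dartCost : E × Bool → ℝ
  | (e, true) => G.cost e
  | (e, false) => -G.cost e

/-- The cost of sending one unit of flow along a sequence of darts. -/
def pathCost (p : List (E × Bool)) : ℝ := (p.map G.dartCost).sum

/-- With respect to the flow `f`, the residual capacity of the dart is greater than `c`. -/
def ResidualGT (f : E → ℝ) (c : ℝ) : E × Bool → Prop
  | (e, true) => ((f e + c : ℝ) : WithTop ℝ) < G.cap e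
  | (e, false) => c < f e

/-- The dart belongs to the residual network of the flow `f`. -/
def Residual (f : E → ℝ) (d : E × Bool) : Prop := G.ResidualGT f 0 d

/-- The list of darts is a walk from `u` to `w`. -/
def IsWalk : V → V → List (E × Bool) → Prop
  | u, w, [] => u = w
  | u, w, d :: p => G.tail d = u ∧ IsWalk (G.head d) w p

/-- The list of darts is a walk from `u` to `w` that uses only arcs of `T`, each at most once. -/
def IsTreePath (T : Set E) (u w : V) (p : List (E × Bool)) : Prop :=
  G.IsWalk u w p ∧ (p.map Prod.fst).Nodup ∧ ∀ d ∈ p, d.1 ∈ T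

/-- `T` is a spanning tree (orientations ignored): any two nodes are joined by exactly one trail
in `T`. The case of equal end nodes excludes cycles, loops and parallel arcs in `T`. -/
def IsSpanningTree (T : Set E) : Prop := ∀ u w : V, ∃! p, G.IsTreePath T u w p

open Classical in
/-- The flow `f` satisfies the supplies and demands of all nodes. -/
def Conserves [Fintype E] (f : E → ℝ) : Prop :=
  ∀ u : V, (∑ e, if G.src e = u then f e else 0) - (∑ e, if G.tgt e = u then f e else 0)
    = G.supply u

/-- A basic feasible solution: a spanning tree (the basis) together with a feasible flow that is
zero or equal to the capacity on each arc outside of the tree. -/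
structure BasicSolution [Fintype E] (G : Network V E) where
  tree : Set E
  flow : E → ℝ
  spanning : G.IsSpanningTree tree
  nonneg : ∀ e, 0 ≤ flow e
  le_cap : ∀ e, (flow e : WithTop ℝ) ≤ G.cap e
  conserves : G.Conserves flow
  nonbasic : ∀ e, e ∉ tree → flow e = 0 ∨ (flow e : WithTop ℝ) = G.cap e

/-- The data of one iteration: the entering dart (the entering arc with the direction in which
flow is sent along it), the leaving arc, and the amount of flow that is sent. -/
structure Pivot (E : Type*) where
  entering : E × Bool
  leaving : E
  amount : ℝ

open Classical in
/-- The flow `f` after sending `θ` units along the darts of `c`. -/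
noncomputable def push (f : E → ℝ) (θ : ℝ) (c : List (E × Bool)) (e : E) : ℝ :=
  f e + (if (e, true) ∈ c then θ else 0) - (if (e, false) ∈ c then θ else 0)

namespace BasicSolution

variable {G} [Fintype E]

/-- The tree-path from `u` to `w`. -/
noncomputable def treePath (x : G.BasicSolution) (u w : V) : List (E × Bool) :=
  (x.spanning u w).choose

theorem isTreePath_treePath (x : G.BasicSolution) (u w : V) :
    G.IsTreePath x.tree u w (x.treePath u w) :=
  (x.spanning u w).choose_spec.1

theorem eq_treePath (x : G.BasicSolution) {u w : V} {p : List (E × Bool)}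
    (h : G.IsTreePath x.tree u w p) : p = x.treePath u w :=
  (x.spanning u w).choose_spec.2 p h

/-- The cycle obtained by adding the dart `d` to the spanning tree, in the direction of `d`. -/
noncomputable def cycle (x : G.BasicSolution) (d : E × Bool) : List (E × Bool) :=
  d :: x.treePath (G.head d) (G.tail d)

/-- The reduced cost of a dart. -/
noncomputable def reducedCost (x : G.BasicSolution) (d : E × Bool) : ℝ :=
  G.pathCost (x.cycle d)

/-- The dart is a residual non-tree arc. -/
def IsCandidate (x : G.BasicSolution) (d : E × Bool) : Prop :=
  d.1 ∉ x.tree ∧ G.Residual x.flow d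

/-- The Network Simplex Algorithm stops: no residual non-tree arc has negative reduced cost. -/
def IsOptimal (x : G.BasicSolution) : Prop :=
  ∀ d, x.IsCandidate d → 0 ≤ x.reducedCost d

/-- One iteration of the Network Simplex Algorithm with Dantzig's pivot rule: a residual non-tree
arc of minimum reduced cost enters the basis, as much flow as possible is sent along the cycle it
closes, and an arc of the cycle that becomes tight leaves the basis. (Ties may be broken in any
way; the bounds on the flow of the result `y` are part of `y`.) -/
structure IsPivot (x : G.BasicSolution) (P : Pivot E) (y : G.BasicSolution) : Prop where
  candidate : x.IsCandidate P.entering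
  improving : x.reducedCost P.entering < 0
  dantzig : ∀ d, x.IsCandidate d → x.reducedCost P.entering ≤ x.reducedCost d
  amount_nonneg : 0 ≤ P.amount
  flow_eq : y.flow = push x.flow P.amount (x.cycle P.entering)
  tight : ∃ d ∈ x.cycle P.entering, d.1 = P.leaving ∧ ¬ G.Residual y.flow d
  tree_eq : y.tree = insert P.entering.1 x.tree \ {P.leaving}

end BasicSolution

end Network

/-! ### The counting gadget -/

/-- The sum `∑_{j = i₁+1}^{i₂} (-1)^{k_{j-1}} v_j`, where `k_j` is the `j`-th bit of `k`. -/
noncomputable def signedSum (v : ℕ → ℝ) (i₁ i₂ k : ℕ) : ℝ :=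
  ∑ j ∈ Finset.Ioc i₁ i₂, (-1 : ℝ) ^ (k / 2 ^ (j - 1) % 2) * v j

/-- The nodes `s_j` and `t_j`. -/
inductive GNode
  | s (j : ℕ)
  | t (j : ℕ)

/-- The arcs `(s_0, t_0)`, and, for `j ≥ 1`, the arcs `(s_j, s_{j-1})`, `(t_{j-1}, t_j)`,
`(s_j, t_{j-1})` and `(s_{j-1}, t_j)`, in this order. -/
inductive GArc
  | base
  | ss (j : ℕ)
  | tt (j : ℕ)
  | st (j : ℕ)
  | ts (j : ℕ)

namespace GArc

def src : GArc → GNode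
  | base => .s 0
  | ss j => .s j
  | tt j => .t (j - 1)
  | st j => .s j
  | ts j => .s (j - 1)

def tgt : GArc → GNode
  | base => .t 0
  | ss j => .s (j - 1)
  | tt j => .t j
  | st j => .t (j - 1)
  | ts j => .t j

noncomputable def cost (v : ℕ → ℝ) (r : ℝ) : GArc → ℝ
  | base => 0
  | ss j => v j / 2
  | tt j => v j / 2
  | st j => 2 ^ (j - 1) - r - v j / 2
  | ts j => 2 ^ (j - 1) - (1 - r) - v j / 2

def cap : GArc → ℝ
  | base => 1
  | ss j => 3 * 2 ^ (j - 1)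
  | tt j => 3 * 2 ^ (j - 1)
  | st j => 3 * 2 ^ (j - 1)
  | ts j => 3 * 2 ^ (j - 1)

end GArc

/-- The nodes of the gadget `S_i`. -/
def gadgetNodes : ℕ → Set GNode
  | 0 => {.s 0, .t 0}
  | i + 1 => gadgetNodes i ∪ {.s (i + 1), .t (i + 1)}

/-- The arcs of the gadget `S_i`. -/
def gadgetArcs : ℕ → Set GArc
  | 0 => {.base}
  | i + 1 => gadgetArcs i ∪ {.ss (i + 1), .tt (i + 1), .st (i + 1), .ts (i + 1)}

/-- The nodes of `S_i` other than `s_i` and `t_i`. -/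
def gadgetInner (i : ℕ) : Set GNode := gadgetNodes i \ {.s i, .t i}

/-- The supply of the inner nodes: supply `1` at `t_0`, demand `1` at `s_0`. -/
def GNode.innerSupply : GNode → ℝ
  | .s j => if j = 0 then -1 else 0
  | .t j => if j = 0 then 1 else 0

/-- The gadget `S_i^{v,r}` as a part of the network `G`, connected to the rest of `G` only at the
nodes `s_i` and `t_i`. -/
structure Gadget {V E : Type*} (G : Network V E) (v : ℕ → ℝ) (r : ℝ) (i : ℕ) where
  node : GNode → V
  arc : GArc → E
  node_injOn : Set.InjOn node (gadgetNodes i)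
  arc_injOn : Set.InjOn arc (gadgetArcs i)
  src_eq : ∀ α ∈ gadgetArcs i, G.src (arc α) = node α.src
  tgt_eq : ∀ α ∈ gadgetArcs i, G.tgt (arc α) = node α.tgt
  cost_eq : ∀ α ∈ gadgetArcs i, G.cost (arc α) = α.cost v r
  cap_eq : ∀ α ∈ gadgetArcs i, G.cap (arc α) = (α.cap : WithTop ℝ)
  supply_eq : ∀ β ∈ gadgetInner i, G.supply (node β) = β.innerSupply
  closed : ∀ e : E, (∃ β ∈ gadgetInner i, G.src e = node β ∨ G.tgt e = node β) →
    e ∈ arc '' gadgetArcs i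

namespace Gadget

variable {V E : Type*} [Fintype E] {G : Network V E} {v : ℕ → ℝ} {r : ℝ} {i : ℕ}

/-- The set of arcs of `G` that belong to the gadget. -/
def arcs (S : Gadget G v r i) : Set E := S.arc '' gadgetArcs i

/-- The initial configuration of the gadget: exactly the arcs of the paths `s_i, …, s_0` and
`t_0, …, t_i` are in the basis; they carry flow `1`, and all other arcs of the gadget carry no
flow. -/
structure IsInitial (S : Gadget G v r i) (x : G.BasicSolution) : Prop where
  mem_tree : ∀ α ∈ gadgetArcs i, S.arc α ∈ x.tree ↔ ∃ j, α = .ss j ∨ α = .tt j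
  flow_path : ∀ α ∈ gadgetArcs i, (∃ j, α = .ss j ∨ α = .tt j) → x.flow (S.arc α) = 1
  flow_other : ∀ α ∈ gadgetArcs i, ¬ (∃ j, α = .ss j ∨ α = .tt j) → x.flow (S.arc α) = 0

/-- There is a tree-path from `t_i` to `s_i` in the residual network of cost smaller than
`-2^(i+1)` and capacity greater than `1`. -/
def CheapPath (S : Gadget G v r i) (x : G.BasicSolution) : Prop :=
  ∃ p, G.IsTreePath x.tree (S.node (.t i)) (S.node (.s i)) p ∧
    G.pathCost p < -2 ^ (i + 1) ∧ ∀ d ∈ p, G.ResidualGT x.flow 1 d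

/-- The iteration routes flow through the gadget: the cycle contains an arc of the gadget. -/
def Uses (S : Gadget G v r i) (x : G.BasicSolution) (P : Network.Pivot E) : Prop :=
  ∃ d ∈ x.cycle P.entering, d.1 ∈ S.arcs

/-- The iteration routes exactly one unit of flow from `s_i` to `t_i` along arcs of the gadget:
up to rotation, the cycle consists of an `s_i`-`t_i`-walk in the gadget and a tree-path from `t_i`
to `s_i` outside of the gadget. -/
def RoutesUnit (S : Gadget G v r i) (x : G.BasicSolution) (P : Network.Pivot E) : Prop :=
  P.amount = 1 ∧ ∃ p q : List (E × Bool),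
    (p ++ q).IsRotated (x.cycle P.entering) ∧
    G.IsWalk (S.node (.s i)) (S.node (.t i)) p ∧ (∀ d ∈ p, d.1 ∈ S.arcs) ∧
    G.IsTreePath x.tree (S.node (.t i)) (S.node (.s i)) q ∧ (∀ d ∈ q, d.1 ∉ S.arcs)

open Classical in
/-- The cost incurred in an iteration by the arcs of the gadget. -/
noncomputable def incurredCost (S : Gadget G v r i) (x : G.BasicSolution)
    (P : Network.Pivot E) : ℝ :=
  P.amount * G.pathCost ((x.cycle P.entering).filter fun d => d.1 ∈ S.arcs)

/-- One of the two arcs `α`, `β` of the gadget enters the basis and the other one leaves it. -/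
def Swaps (S : Gadget G v r i) (P : Network.Pivot E) (α β : GArc) : Prop :=
  (P.entering.1 = S.arc α ∧ P.leaving = S.arc β) ∨
  (P.entering.1 = S.arc β ∧ P.leaving = S.arc α)

end Gadget

/-! The gadget counts by recursion, and the sequence of its states is fixed in advance, whatever the
rest of the network does in between. Let E = 3·2^i − 2 be the number of steps of S_i; the next level
takes 2E + 2. While S_i runs inside S_{i+1}, each unit passes s_{i+1}, s_i, S_i, t_i, t_{i+1}. The
arcs `ss (i+1)` and `tt (i+1)` start with flow 1, so after E steps each has exactly one free unit.
Two steps along the paths `ss`, `ts` and `st`, `tt`, of costs 2^i − (1 − r) and 2^i − r, the cheaper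
one first, saturate these arcs and put `ts` and `st` into the basis instead. Now a unit from s_{i+1}
enters S_i at t_i and leaves it at s_i, so the run of S_i is undone in reverse order. Step p of this
phase undoes step q, where p + q = 2E + 1, and its cost is 2^{i+1} − 1 − v_{i+1} minus that of step
q. This reflection complements binary digits, which gives the cost formulas.

That Dantzig's rule follows this run is the invariant `Classified`. A possible entering dart of the
gadget closes a cycle that crosses the gadget from s_i to t_i, or from t_i to s_i, or stays inside.
Crossings of the first kind are completed by the outer path of cost below −2^{i+1}; the prescribed
dart is the strictly cheapest, because Σ|v_j| is smaller than r and 1 − r, and r ≠ 1/2. Crossings of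
the second kind have positive reduced cost, since the costs of the steps of the run stay below 2^i;
cycles inside have nonnegative cost. As S_{i+1} undoes S_i, the induction must also carry that
undoing the last step is the strictly cheapest backward crossing. The induction is `isRun_succ`.

The transfer to G rests on `Separates`: the basis never joins s_i to t_i inside the gadget, so
tree-paths between other nodes avoid it (`Matches.notMem_arcs`). An iteration whose cycle avoids the
gadget leaves its state unchanged; one that uses it must have its entering arc there, hence performs
the next step of the run (`Matches.step`). The outer path has capacity above 1, so the bottleneck is
the prescribed leaving arc with residual capacity 1. -/

/-! ### Darts, walks, threads and pushing flow -/

/-- The dart with the same arc and the opposite direction. -/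
def flipDart {E : Type*} (d : E × Bool) : E × Bool := (d.1, !d.2)

theorem flipDart_flipDart {E : Type*} (d : E × Bool) : flipDart (flipDart d) = d := by
  simp [flipDart]

/-- The reversed sequence of darts. -/
def flipWalk {E : Type*} (w : List (E × Bool)) : List (E × Bool) := (w.map flipDart).reverse

theorem mem_flipWalk {E : Type*} {w : List (E × Bool)} {d : E × Bool} :
    d ∈ flipWalk w ↔ flipDart d ∈ w := by
  simp only [flipWalk, List.mem_reverse, List.mem_map]
  constructor
  · rintro ⟨e, he, rfl⟩
    rwa [flipDart_flipDart]
  · exact fun h => ⟨_, h, flipDart_flipDart d⟩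

theorem map_fst_flipWalk {E : Type*} (w : List (E × Bool)) :
    (flipWalk w).map Prod.fst = (w.map Prod.fst).reverse := by
  simp [flipWalk, flipDart, Function.comp_def]

theorem eq_of_nodup_fst {E : Type*} {w : List (E × Bool)} (h : (w.map Prod.fst).Nodup)
    {d e : E × Bool} (hd : d ∈ w) (he : e ∈ w) (hde : d.1 = e.1) : d = e :=
  List.inj_on_of_nodup_map h hd he hde

namespace Network

variable {V E : Type*} (G : Network V E)

theorem tail_flipDart (d : E × Bool) : G.tail (flipDart d) = G.head d := by
  rcases d with ⟨e, _ | _⟩ <;> rfl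

theorem head_flipDart (d : E × Bool) : G.head (flipDart d) = G.tail d := by
  rcases d with ⟨e, _ | _⟩ <;> rfl

theorem dartCost_flipDart (d : E × Bool) : G.dartCost (flipDart d) = -G.dartCost d := by
  rcases d with ⟨e, _ | _⟩ <;> simp [dartCost, flipDart]

theorem pathCost_nil : G.pathCost [] = 0 := rfl

theorem pathCost_cons (d : E × Bool) (w : List (E × Bool)) :
    G.pathCost (d :: w) = G.dartCost d + G.pathCost w := by
  simp [pathCost]

theorem pathCost_append (p q : List (E × Bool)) :
    G.pathCost (p ++ q) = G.pathCost p + G.pathCost q := by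
  simp [pathCost]

theorem pathCost_flipWalk (w : List (E × Bool)) : G.pathCost (flipWalk w) = -G.pathCost w := by
  induction w with
  | nil => simp [flipWalk, pathCost]
  | cons d w ih =>
    have : flipWalk (d :: w) = flipWalk w ++ [flipDart d] := by simp [flipWalk]
    rw [this, pathCost_append, ih, pathCost_cons, pathCost_cons, dartCost_flipDart, pathCost_nil]
    ring

variable {G}

theorem isWalk_append {u w : V} {p q : List (E × Bool)} :
    G.IsWalk u w (p ++ q) ↔ ∃ m, G.IsWalk u m p ∧ G.IsWalk m w q := by
  induction p generalizing u with
  | nil => simp [IsWalk]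
  | cons d p ih => simp [IsWalk, ih, and_assoc]

theorem IsWalk.append {u m w : V} {p q : List (E × Bool)} (hp : G.IsWalk u m p)
    (hq : G.IsWalk m w q) : G.IsWalk u w (p ++ q) :=
  isWalk_append.2 ⟨m, hp, hq⟩

theorem IsWalk.flipWalk {u w : V} {p : List (E × Bool)} (h : G.IsWalk u w p) :
    G.IsWalk w u (flipWalk p) := by
  induction p generalizing u with
  | nil => exact Eq.symm h
  | cons d p ih =>
    have : _root_.flipWalk (d :: p) = _root_.flipWalk p ++ [flipDart d] := by
      simp [_root_.flipWalk]
    rw [this]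
    refine (ih h.2).append ⟨G.tail_flipDart d, ?_⟩
    rw [G.head_flipDart]
    exact h.1

/-- The walk `w` from `a` to `b` uses the dart `d`, and apart from that only arcs of `T`; each arc
is used at most once. -/
structure IsThread (G : Network V E) (T : Set E) (a b : V) (d : E × Bool)
    (w : List (E × Bool)) : Prop where
  walk : G.IsWalk a b w
  nodup : (w.map Prod.fst).Nodup
  mem : d ∈ w
  tree : ∀ e ∈ w, e ≠ d → e.1 ∈ T

theorem IsThread.eq_of_fst {T : Set E} {a b : V} {d : E × Bool} {w : List (E × Bool)}
    (h : G.IsThread T a b d w) {e f : E × Bool} (he : e ∈ w) (hf : f ∈ w) (hef : e.1 = f.1) :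
    e = f := eq_of_nodup_fst h.nodup he hf hef

/-- Closing a thread by a path of `T` gives the path of `T` that closes a cycle with its dart. -/
theorem IsThread.close {T : Set E} {a b : V} {d : E × Bool} {w q : List (E × Bool)}
    (h : G.IsThread T a b d w) (hq : G.IsTreePath T b a q)
    (hwq : ∀ e ∈ w, ∀ f ∈ q, e.1 ≠ f.1) :
    ∃ p₁ p₂, w = p₁ ++ d :: p₂ ∧ G.IsTreePath T (G.head d) (G.tail d) (p₂ ++ q ++ p₁) := by
  obtain ⟨p₁, p₂, rfl⟩ := List.append_of_mem h.mem
  refine ⟨p₁, p₂, rfl, ?_, ?_, ?_⟩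
  · obtain ⟨m, h₁, h₂, h₃⟩ := isWalk_append.1 h.walk
    subst h₂
    exact (h₃.append hq.1).append h₁
  · have hn := h.nodup
    have hq' := hq.2.1
    simp only [List.map_append, List.map_cons, List.nodup_append, List.nodup_cons,
      List.mem_append, List.mem_cons, List.mem_map] at hn ⊢
    refine ⟨⟨hn.2.1.2, hq', ?_⟩, hn.1, ?_⟩
    · rintro _ ⟨e, he, rfl⟩ _ ⟨f, hf, rfl⟩
      exact hwq e (by simp [he]) f hf
    · rintro _ (⟨e, he, rfl⟩ | ⟨f, hf, rfl⟩) _ ⟨g, hg, rfl⟩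
      · exact fun hh => hn.2.2 _ ⟨g, hg, rfl⟩ _ (Or.inr ⟨e, he, rfl⟩) hh.symm
      · exact fun hh => hwq g (by simp [hg]) f hf hh.symm
  · intro e he
    simp only [List.mem_append] at he
    have hd : ∀ e ∈ p₁ ++ p₂, e ≠ d := by
      rintro e he rfl
      have hn := h.nodup
      simp only [List.map_append, List.map_cons, List.nodup_append, List.nodup_cons,
        List.mem_cons, List.mem_map] at hn
      rcases List.mem_append.1 he with he | he
      · exact hn.2.2 _ ⟨e, he, rfl⟩ _ (Or.inl rfl) rfl
      · exact hn.2.1.1 ⟨e, he, rfl⟩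
    rcases he with (he | he) | he
    · exact h.tree e (by simp [he]) (hd e (by simp [he]))
    · exact hq.2.2 e he
    · exact h.tree e (by simp [he]) (hd e (by simp [he]))

/-- The distinguished dart changes from `d` to `d'`: after a pivot the leaving arc is the only arc
of the thread outside the basis, and the reversed thread belongs to it. -/
theorem IsThread.flipWalk {T T' : Set E} {a b : V} {d d' : E × Bool} {w : List (E × Bool)}
    (h : G.IsThread T a b d w) (hd' : d' ∈ w) (hT : ∀ e ∈ w, e ≠ d' → e.1 ∈ T') :
    G.IsThread T' b a (flipDart d') (flipWalk w) where
  walk := h.walk.flipWalk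
  nodup := by
    rw [map_fst_flipWalk]
    exact List.nodup_reverse.2 h.nodup
  mem := by rwa [mem_flipWalk, flipDart_flipDart]
  tree := by
    intro e he hne
    refine hT (_root_.flipDart e) (mem_flipWalk.1 he) ?_
    rintro rfl
    exact hne (flipDart_flipDart e).symm

/-- Prolonging a thread by one dart at each end. -/
theorem IsThread.extend {T T' : Set E} {a b a' b' : V} {d x y : E × Bool} {w : List (E × Bool)}
    (h : G.IsThread T a b d w) (hT : ∀ e ∈ w, e ≠ d → e.1 ∈ T → e.1 ∈ T')
    (hx : x.1 ∈ T') (hy : y.1 ∈ T') (hxy : x.1 ≠ y.1)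
    (hxw : ∀ e ∈ w, e.1 ≠ x.1) (hyw : ∀ e ∈ w, e.1 ≠ y.1)
    (hxa : G.tail x = a') (hxa' : G.head x = a) (hyb : G.tail y = b) (hyb' : G.head y = b') :
    G.IsThread T' a' b' d (x :: (w ++ [y])) where
  walk := ⟨hxa, hxa' ▸ h.walk.append ⟨hyb, hyb'⟩⟩
  nodup := by
    have := h.nodup
    simp only [List.map_append, List.map_cons, List.map_nil, List.nodup_cons, List.mem_append,
      List.mem_map, List.mem_singleton, List.nodup_append, not_or]
    refine ⟨⟨?_, hxy⟩, this, by simp, ?_⟩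
    · rintro ⟨e, he, he'⟩
      exact hxw e he he'
    · rintro _ ⟨e, he, rfl⟩ _ rfl
      exact hyw e he
  mem := by simp [h.mem]
  tree := by
    intro e he hne
    simp only [List.mem_cons, List.mem_append, List.not_mem_nil, or_false] at he
    rcases he with rfl | he | rfl
    · exact hx
    · exact hT e he hne (h.tree e he hne)
    · exact hy

theorem push_of_mem {f : E → ℝ} {θ : ℝ} {w : List (E × Bool)} (h : (w.map Prod.fst).Nodup)
    {d : E × Bool} (hd : d ∈ w) : push f θ w d.1 = f d.1 + if d.2 then θ else -θ := by
  rcases d with ⟨e, _ | _⟩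
  · have : (e, true) ∉ w := fun h' => by simpa using eq_of_nodup_fst h hd h' rfl
    simp only [push, hd, this, if_true, if_false, Bool.false_eq_true]
    ring
  · have : (e, false) ∉ w := fun h' => by simpa using eq_of_nodup_fst h hd h' rfl
    simp only [push, hd, this, if_true, if_false]
    ring

theorem push_of_notMem {f : E → ℝ} {θ : ℝ} {w : List (E × Bool)} {e : E}
    (he : ∀ d ∈ w, d.1 ≠ e) : push f θ w e = f e := by
  have h₁ : (e, true) ∉ w := fun h => he _ h rfl
  have h₂ : (e, false) ∉ w := fun h => he _ h rfl
  simp [push, h₁, h₂]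

/-- The two flows may live on different arc types, so this serves both for passing from S_i to
S_{i+1} and for passing from the gadget to G. -/
theorem push_congr {E' : Type*} {f : E → ℝ} {f' : E' → ℝ} {θ : ℝ} {w : List (E × Bool)}
    {w' : List (E' × Bool)} {e : E} {e' : E'} (hf : f e = f' e')
    (hw : ∀ b, (e, b) ∈ w ↔ (e', b) ∈ w') : push f θ w e = push f' θ w' e' := by
  by_cases h₁ : (e', true) ∈ w' <;> by_cases h₂ : (e', false) ∈ w' <;>
    simp [push, hf, (hw true), (hw false), h₁, h₂]

end Network

/-! ### The gadget in isolation: local states and single steps -/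

section

open Network

/-- The arcs of all the gadgets `S_i^{v,r}` as a network. -/
noncomputable def gadgetNet (v : ℕ → ℝ) (r : ℝ) : Network GNode GArc where
  src := GArc.src
  tgt := GArc.tgt
  cost := GArc.cost v r
  cap α := (α.cap : WithTop ℝ)
  supply := GNode.innerSupply

/-- The index of the gadget in which the arc occurs first. -/
def GArc.level : GArc → ℕ
  | base => 0
  | ss j => j
  | tt j => j
  | st j => j
  | ts j => j

theorem level_le_of_mem_gadgetArcs {i : ℕ} {α : GArc} (h : α ∈ gadgetArcs i) : α.level ≤ i := by
  induction i with
  | zero =>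
    obtain rfl : α = .base := h
    exact le_rfl
  | succ i ih =>
    rcases h with h | rfl | rfl | rfl | rfl
    · exact (ih h).trans (Nat.le_succ i)
    all_goals exact le_rfl

theorem level_ne_of_mem_gadgetArcs {i : ℕ} {α : GArc} (h : α ∈ gadgetArcs i) :
    α.level ≠ i + 1 := by
  have := level_le_of_mem_gadgetArcs h
  omega

theorem mem_gadgetArcs_succ {i : ℕ} {α : GArc} :
    α ∈ gadgetArcs (i + 1) ↔
      α ∈ gadgetArcs i ∨ α = .ss (i + 1) ∨ α = .tt (i + 1) ∨ α = .st (i + 1) ∨ α = .ts (i + 1) :=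
  Iff.rfl

theorem mem_gadgetArcs_of_level {i : ℕ} {α : GArc} (h : α.level = i + 1) :
    α ∈ gadgetArcs (i + 1) := by
  rw [mem_gadgetArcs_succ]
  rcases α with _ | j | j | j | j <;> simp only [GArc.level] at h <;> subst_vars <;> simp
  omega

theorem gadgetArcs_mono_succ (i : ℕ) : gadgetArcs i ⊆ gadgetArcs (i + 1) :=
  fun _ h => Or.inl h

theorem base_mem_gadgetArcs (i : ℕ) : GArc.base ∈ gadgetArcs i := by
  induction i with
  | zero => rfl
  | succ i ih => exact Or.inl ih

/-- Which arcs of a gadget are in the basis, and the flow on them. -/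
structure GadgetState where
  tree : Set GArc
  flow : GArc → ℝ

namespace GadgetState

/-- The residual capacity of a dart. -/
def rescap (X : GadgetState) : GArc × Bool → ℝ
  | (α, true) => α.cap - X.flow α
  | (α, false) => X.flow α

theorem rescap_flipDart (X : GadgetState) (d : GArc × Bool) :
    X.rescap (flipDart d) = d.1.cap - X.rescap d := by
  rcases d with ⟨α, _ | _⟩ <;> simp [rescap, flipDart]

/-- The state that is given by `L` on the arcs that are in `S_{i+1}` but not in `S_i` and by `X`
on the others. -/
def extend (i : ℕ) (X L : GadgetState) : GadgetState where
  tree := {α | if α.level = i + 1 then α ∈ L.tree else α ∈ X.tree}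
  flow α := if α.level = i + 1 then L.flow α else X.flow α

variable {i : ℕ} {X L : GadgetState} {α : GArc}

theorem mem_tree_extend_of_mem (h : α ∈ gadgetArcs i) :
    α ∈ (extend i X L).tree ↔ α ∈ X.tree := by
  simp [extend, level_ne_of_mem_gadgetArcs h]

theorem flow_extend_of_mem (h : α ∈ gadgetArcs i) : (extend i X L).flow α = X.flow α := by
  simp [extend, level_ne_of_mem_gadgetArcs h]

theorem mem_tree_extend_of_level (h : α.level = i + 1) :
    α ∈ (extend i X L).tree ↔ α ∈ L.tree := by
  simp [extend, h]

theorem flow_extend_of_level (h : α.level = i + 1) : (extend i X L).flow α = L.flow α := by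
  simp [extend, h]

theorem rescap_extend_of_mem {d : GArc × Bool} (h : d.1 ∈ gadgetArcs i) :
    (extend i X L).rescap d = X.rescap d := by
  rcases d with ⟨α, _ | _⟩ <;> simp [rescap, flow_extend_of_mem h]

theorem rescap_extend_of_level {d : GArc × Bool} (h : d.1.level = i + 1) :
    (extend i X L).rescap d = L.rescap d := by
  rcases d with ⟨α, _ | _⟩ <;> simp [rescap, flow_extend_of_level h]

end GadgetState

open GadgetState

/-- A thread within the gadget `S_i`. -/
structure GadgetThread (i : ℕ) (T : Set GArc) (a b : GNode) (d : GArc × Bool)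
    (w : List (GArc × Bool)) : Prop extends (gadgetNet 0 0).IsThread T a b d w where
  arcs : ∀ e ∈ w, e.1 ∈ gadgetArcs i

/-- One unit of flow is sent in the gadget `S_i` from `a` to `b` along the thread `w`; the dart `δ`
enters the basis and the dart `l` leaves it. -/
structure GadgetStep (i : ℕ) (a b : GNode) (X : GadgetState) (w : List (GArc × Bool))
    (δ l : GArc × Bool) (X' : GadgetState) : Prop extends GadgetThread i X.tree a b δ w where
  notMem_tree : δ.1 ∉ X.tree
  leaving_mem : l ∈ w
  rescap_entering : X.rescap δ = δ.1.cap
  rescap_lt : ∀ e ∈ w, e ≠ δ → X.rescap e < e.1.cap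
  rescap_leaving : X.rescap l = 1
  one_lt_rescap : ∀ e ∈ w, e ≠ l → 1 < X.rescap e
  tree_eq : ∀ α ∈ gadgetArcs i, α ∈ X'.tree ↔ (α = δ.1 ∨ α ∈ X.tree) ∧ α ≠ l.1
  flow_eq : ∀ α ∈ gadgetArcs i, X'.flow α = push X.flow 1 w α

/-- Endpoints of arcs do not depend on `v` and `r`; walks are therefore taken in `gadgetNet 0 0`,
and only costs refer to `gadgetNet v r`. -/
theorem GadgetThread.extend {i : ℕ} {T T' : Set GArc} {a b a' b' : GNode}
    {d x y : GArc × Bool} {w : List (GArc × Bool)} (h : GadgetThread i T a b d w)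
    (hT : ∀ α ∈ gadgetArcs i, α ∈ T → α ∈ T')
    (hx : x.1 ∈ T') (hy : y.1 ∈ T') (hxy : x.1 ≠ y.1)
    (hxi : x.1.level = i + 1) (hyi : y.1.level = i + 1)
    (hxa : (gadgetNet 0 0).tail x = a') (hxa' : (gadgetNet 0 0).head x = a)
    (hyb : (gadgetNet 0 0).tail y = b) (hyb' : (gadgetNet 0 0).head y = b') :
    GadgetThread (i + 1) T' a' b' d (x :: (w ++ [y])) where
  toIsThread := h.toIsThread.extend (fun e he _ => hT e.1 (h.arcs e he)) hx hy hxy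
    (fun e he hh => level_ne_of_mem_gadgetArcs (h.arcs e he) (hh ▸ hxi))
    (fun e he hh => level_ne_of_mem_gadgetArcs (h.arcs e he) (hh ▸ hyi)) hxa hxa' hyb hyb'
  arcs := by
    intro e he
    simp only [List.mem_cons, List.mem_append, List.not_mem_nil, or_false] at he
    rcases he with rfl | he | rfl
    · exact mem_gadgetArcs_of_level hxi
    · exact gadgetArcs_mono_succ i (h.arcs e he)
    · exact mem_gadgetArcs_of_level hyi

namespace GadgetStep

variable {i : ℕ} {a b : GNode} {X X' : GadgetState} {w : List (GArc × Bool)} {δ l : GArc × Bool}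

/-- The arc missing from the basis on the thread moves from `δ` to `l`. This includes the case `δ =
l`, in which the basis does not change. -/
theorem mem_tree_iff (h : GadgetStep i a b X w δ l X') {e : GArc × Bool} (he : e ∈ w) :
    e.1 ∈ X'.tree ↔ e ≠ l := by
  rw [h.tree_eq _ (h.arcs e he)]
  constructor
  · rintro ⟨-, h'⟩ rfl
    exact h' rfl
  · intro hne
    refine ⟨?_, fun hh => hne (h.eq_of_fst he h.leaving_mem hh)⟩
    by_cases hd : e = δ
    · exact Or.inl (hd ▸ rfl)
    · exact Or.inr (h.tree e he hd)

theorem flow_of_mem (h : GadgetStep i a b X w δ l X') {e : GArc × Bool} (he : e ∈ w) :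
    X'.flow e.1 = X.flow e.1 + if e.2 then 1 else -1 := by
  rw [h.flow_eq _ (h.arcs e he), push_of_mem h.nodup he]

theorem rescap_of_mem (h : GadgetStep i a b X w δ l X') {e : GArc × Bool} (he : e ∈ w) :
    X'.rescap e = X.rescap e - 1 := by
  have := h.flow_of_mem he
  rcases e with ⟨e, _ | _⟩ <;> simp only [rescap, this] <;> simp <;> ring

/-- Undoing a step. -/
theorem symm (h : GadgetStep i a b X w δ l X') :
    GadgetStep i b a X' (flipWalk w) (flipDart l) (flipDart δ) X where
  toIsThread := h.toIsThread.flipWalk h.leaving_mem fun e he hne => (h.mem_tree_iff he).2 hne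
  arcs e he := h.arcs (flipDart e) (mem_flipWalk.1 he)
  notMem_tree hl := (h.mem_tree_iff h.leaving_mem).1 hl rfl
  leaving_mem := by rw [mem_flipWalk, flipDart_flipDart]; exact h.mem
  -- A unit push lowers a residual capacity by 1, and the opposite dart has the complement to the
  -- capacity. Thus "residual capacity 1 exactly at `l`, else larger" and "full residual capacity
  -- exactly at `δ`, else smaller" are exchanged by reversal.
  rescap_entering := by
    rw [rescap_flipDart, h.rescap_of_mem h.leaving_mem, h.rescap_leaving]
    simp [flipDart]
  rescap_lt e he hne := by
    have he' := mem_flipWalk.1 he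
    have hne' : flipDart e ≠ l := by
      rintro rfl
      exact hne (flipDart_flipDart e).symm
    have h₁ := h.one_lt_rescap _ he' hne'
    have h₂ := h.rescap_of_mem he'
    have h₃ := X'.rescap_flipDart e
    linarith
  rescap_leaving := by
    rw [rescap_flipDart, h.rescap_of_mem h.mem, h.rescap_entering]
    ring
  one_lt_rescap e he hne := by
    have he' := mem_flipWalk.1 he
    have hne' : flipDart e ≠ δ := by
      rintro rfl
      exact hne (flipDart_flipDart e).symm
    have h₁ := h.rescap_lt _ he' hne'
    have h₂ := h.rescap_of_mem he'
    have h₃ := X'.rescap_flipDart e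
    have h₄ : (flipDart e).1 = e.1 := rfl
    rw [h₄] at h₁
    linarith
  tree_eq α hα := by
    have h₁ := h.tree_eq α hα
    simp only [flipDart, h₁]
    by_cases hl : α = l.1
    · subst hl
      -- Equality occurs for the base arc, which only switches between its two bounds.
      by_cases hlδ : l = δ
      · subst hlδ
        simp [h.notMem_tree]
      · have : l.1 ≠ δ.1 := fun hh => hlδ (h.eq_of_fst h.leaving_mem h.mem hh)
        simp [h.tree l h.leaving_mem hlδ, this]
    · by_cases hδ : α = δ.1
      · subst hδ
        simp [h.notMem_tree]
      · simp [hl, hδ]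
  flow_eq α hα := by
    have hn : ((flipWalk w).map Prod.fst).Nodup := by
      rw [map_fst_flipWalk]
      exact List.nodup_reverse.2 h.nodup
    by_cases hw : ∃ e ∈ w, e.1 = α
    · obtain ⟨e, he, rfl⟩ := hw
      have he' : flipDart e ∈ flipWalk w := by rwa [mem_flipWalk, flipDart_flipDart]
      have := push_of_mem (f := X'.flow) (θ := 1) hn he'
      rw [show (flipDart e).1 = e.1 from rfl, h.flow_of_mem he] at this
      rw [this]
      rcases e with ⟨e, _ | _⟩ <;> simp [flipDart]
    · push Not at hw
      rw [push_of_notMem fun d hd => hw (flipDart d) (mem_flipWalk.1 hd), h.flow_eq α hα,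
        push_of_notMem hw]

/-- A step in `S_i` gives a step in `S_{i+1}` that sends one unit of flow along additional darts
`x` and `y`. -/
theorem extend (h : GadgetStep i a b X w δ l X') {L L' : GadgetState} {a' b' : GNode}
    {x y : GArc × Bool}
    (hx : x.1 ∈ L.tree) (hy : y.1 ∈ L.tree) (hxy : x.1 ≠ y.1)
    (hxi : x.1.level = i + 1) (hyi : y.1.level = i + 1)
    (hxa : (gadgetNet 0 0).tail x = a') (hxa' : (gadgetNet 0 0).head x = a)
    (hyb : (gadgetNet 0 0).tail y = b) (hyb' : (gadgetNet 0 0).head y = b')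
    (hx₁ : 1 < L.rescap x) (hy₁ : 1 < L.rescap y)
    (hx₂ : L.rescap x < x.1.cap) (hy₂ : L.rescap y < y.1.cap)
    (hT : ∀ α, α.level = i + 1 → (α ∈ L'.tree ↔ α ∈ L.tree))
    (hf : ∀ α, α.level = i + 1 → L'.flow α = push L.flow 1 [x, y] α) :
    GadgetStep (i + 1) a' b' (GadgetState.extend i X L) (x :: (w ++ [y])) δ l
      (GadgetState.extend i X' L') where
  toGadgetThread := h.toGadgetThread.extend (fun α hα hα' => (mem_tree_extend_of_mem hα).2 hα')
    ((mem_tree_extend_of_level hxi).2 hx) ((mem_tree_extend_of_level hyi).2 hy) hxy hxi hyi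
    hxa hxa' hyb hyb'
  notMem_tree := by
    rw [mem_tree_extend_of_mem (h.arcs _ h.mem)]
    exact h.notMem_tree
  leaving_mem := by simp [h.leaving_mem]
  rescap_entering := by
    rw [rescap_extend_of_mem (h.arcs _ h.mem)]
    exact h.rescap_entering
  rescap_lt e he hne := by
    simp only [List.mem_cons, List.mem_append, List.not_mem_nil, or_false] at he
    rcases he with rfl | he | rfl
    · rwa [rescap_extend_of_level hxi]
    · rw [rescap_extend_of_mem (h.arcs _ he)]
      exact h.rescap_lt e he hne
    · rwa [rescap_extend_of_level hyi]
  rescap_leaving := by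
    rw [rescap_extend_of_mem (h.arcs _ h.leaving_mem)]
    exact h.rescap_leaving
  one_lt_rescap e he hne := by
    simp only [List.mem_cons, List.mem_append, List.not_mem_nil, or_false] at he
    rcases he with rfl | he | rfl
    · rwa [rescap_extend_of_level hxi]
    · rw [rescap_extend_of_mem (h.arcs _ he)]
      exact h.one_lt_rescap e he hne
    · rwa [rescap_extend_of_level hyi]
  tree_eq α hα := by
    by_cases hi : α.level = i + 1
    · rw [mem_tree_extend_of_level hi, mem_tree_extend_of_level hi, hT α hi]
      have h₁ : α ≠ δ.1 := by
        rintro rfl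
        exact level_ne_of_mem_gadgetArcs (h.arcs _ h.mem) hi
      have h₂ : α ≠ l.1 := by
        rintro rfl
        exact level_ne_of_mem_gadgetArcs (h.arcs _ h.leaving_mem) hi
      simp [h₁, h₂]
    · have hα' : α ∈ gadgetArcs i := by
        rcases hα with hα | rfl | rfl | rfl | rfl
        · exact hα
        all_goals exact absurd rfl hi
      rw [mem_tree_extend_of_mem hα', mem_tree_extend_of_mem hα', h.tree_eq α hα']
  flow_eq α hα := by
    by_cases hi : α.level = i + 1
    · rw [flow_extend_of_level hi, hf α hi]
      refine push_congr (flow_extend_of_level hi).symm fun c => ?_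
      have : (α, c) ∉ w := fun hw => level_ne_of_mem_gadgetArcs (h.arcs _ hw) hi
      simp [this]
    · have hα' : α ∈ gadgetArcs i := by
        rcases hα with hα | rfl | rfl | rfl | rfl
        · exact hα
        all_goals exact absurd rfl hi
      rw [flow_extend_of_mem hα', h.flow_eq α hα']
      refine push_congr (flow_extend_of_mem hα').symm fun c => ?_
      have h₁ : (α, c) ≠ x := by
        rintro rfl
        exact hi hxi
      have h₂ : (α, c) ≠ y := by
        rintro rfl
        exact hi hyi
      simp [h₁, h₂]

end GadgetStep

/-! ### Runs of the gadget and their recursive construction -/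

/-- The number of iterations that route flow through the gadget `S_i`. -/
def gadgetLength (i : ℕ) : ℕ := 3 * 2 ^ i - 2

theorem gadgetLength_add_two (i : ℕ) : gadgetLength i + 2 = 3 * 2 ^ i := by
  have := Nat.one_le_two_pow (n := i)
  unfold gadgetLength
  omega

/-- The run of S_i, two exchanges of outer arcs, and the run of S_i undone. -/
theorem gadgetLength_succ (i : ℕ) : gadgetLength (i + 1) = 2 * gadgetLength i + 2 := by
  have h₁ := gadgetLength_add_two i
  have h₂ := gadgetLength_add_two (i + 1)
  rw [pow_succ] at h₂
  omega

theorem cast_gadgetLength (i : ℕ) : (gadgetLength i : ℝ) = 3 * 2 ^ i - 2 := by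
  have := gadgetLength_add_two i
  have : ((gadgetLength i + 2 : ℕ) : ℝ) = ((3 * 2 ^ i : ℕ) : ℝ) := by rw [this]
  push_cast at this
  linarith

theorem src_mem_gadgetNodes {i : ℕ} {α : GArc} (h : α ∈ gadgetArcs i) : α.src ∈ gadgetNodes i := by
  induction i with
  | zero =>
    obtain rfl : α = .base := h
    simp [GArc.src, gadgetNodes]
  | succ i ih =>
    have hs : ∀ i, GNode.s i ∈ gadgetNodes i := by rintro (_ | i) <;> simp [gadgetNodes]
    have ht : ∀ i, GNode.t i ∈ gadgetNodes i := by rintro (_ | i) <;> simp [gadgetNodes]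
    rcases h with h | rfl | rfl | rfl | rfl
    · exact Or.inl (ih h)
    · exact hs (i + 1)
    · exact Or.inl (ht i)
    · exact hs (i + 1)
    · exact Or.inl (hs i)

theorem tgt_mem_gadgetNodes {i : ℕ} {α : GArc} (h : α ∈ gadgetArcs i) : α.tgt ∈ gadgetNodes i := by
  induction i with
  | zero =>
    obtain rfl : α = .base := h
    simp [GArc.tgt, gadgetNodes]
  | succ i ih =>
    have hs : ∀ i, GNode.s i ∈ gadgetNodes i := by rintro (_ | i) <;> simp [gadgetNodes]
    have ht : ∀ i, GNode.t i ∈ gadgetNodes i := by rintro (_ | i) <;> simp [gadgetNodes]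
    rcases h with h | rfl | rfl | rfl | rfl
    · exact Or.inl (ih h)
    · exact Or.inl (hs i)
    · exact ht (i + 1)
    · exact Or.inl (ht i)
    · exact ht (i + 1)

theorem s_mem_gadgetNodes {i j : ℕ} : GNode.s j ∈ gadgetNodes i ↔ j ≤ i := by
  induction i with
  | zero => simp [gadgetNodes]
  | succ i ih => simp [gadgetNodes, ih]; omega

theorem t_mem_gadgetNodes {i j : ℕ} : GNode.t j ∈ gadgetNodes i ↔ j ≤ i := by
  induction i with
  | zero => simp [gadgetNodes]
  | succ i ih => simp [gadgetNodes, ih]; omega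

/-- The set `κ` separates `s_i` from `t_i`, and no arc of `T` in the gadget `S_i` leaves it. -/
structure Separates (i : ℕ) (T : Set GArc) (κ : Set GNode) : Prop where
  s_mem : GNode.s i ∈ κ
  t_notMem : GNode.t i ∉ κ
  src_iff_tgt : ∀ α ∈ gadgetArcs i, α ∈ T → (α.src ∈ κ ↔ α.tgt ∈ κ)

/-- States of a gadget, and for each of them the walk along which flow is sent next and the darts
that enter and leave the basis. -/
structure GadgetRun where
  state : ℕ → GadgetState
  walk : ℕ → List (GArc × Bool)
  entering : ℕ → GArc × Bool
  leaving : ℕ → GArc × Bool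

namespace GadgetRun

/-- The cost incurred by the gadget in an iteration. -/
noncomputable def cost (C : GadgetRun) (v : ℕ → ℝ) (r : ℝ) (p : ℕ) : ℝ :=
  (gadgetNet v r).pathCost (C.walk p)

/-- The possible entering darts of a state: the thread through `d` joins `s_i` to `t_i` and is more
expensive than the thread of the next entering dart, or it joins `t_i` to `s_i` and is more
expensive than undoing the last step, or else `d` closes a cycle of nonnegative cost in the
gadget. -/
def Classified (C : GadgetRun) (v : ℕ → ℝ) (r : ℝ) (i p : ℕ) (d : GArc × Bool) : Prop :=
  (∃ w, GadgetThread i (C.state p).tree (.s i) (.t i) d w ∧ p < gadgetLength i ∧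
    ((d = C.entering p ∧ (gadgetNet v r).pathCost w = C.cost v r p) ∨
      C.cost v r p < (gadgetNet v r).pathCost w)) ∨
  (∃ w, GadgetThread i (C.state p).tree (.t i) (.s i) d w ∧ 0 < p ∧
    ((d = flipDart (C.leaving (p - 1)) ∧ (gadgetNet v r).pathCost w = -C.cost v r (p - 1)) ∨
      -C.cost v r (p - 1) < (gadgetNet v r).pathCost w)) ∨
  ∃ w, (gadgetNet 0 0).IsTreePath (C.state p).tree ((gadgetNet 0 0).head d)
    ((gadgetNet 0 0).tail d) w ∧ (∀ e ∈ w, e.1 ∈ gadgetArcs i) ∧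
    0 ≤ (gadgetNet v r).dartCost d + (gadgetNet v r).pathCost w

/-- One of the two arcs enters the basis and the other one leaves it. -/
def Swaps (C : GadgetRun) (p : ℕ) (α β : GArc) : Prop :=
  ((C.entering p).1 = α ∧ (C.leaving p).1 = β) ∨ ((C.entering p).1 = β ∧ (C.leaving p).1 = α)

/-- The run describes the behaviour of the gadget `S_i^{v,r}`. -/
structure IsRun (C : GadgetRun) (v : ℕ → ℝ) (r : ℝ) (i : ℕ) : Prop where
  init_tree : ∀ α ∈ gadgetArcs i, α ∈ (C.state 0).tree ↔ ∃ j, α = .ss j ∨ α = .tt j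
  init_flow : ∀ α ∈ gadgetArcs i, (α ∈ (C.state 0).tree → (C.state 0).flow α = 1) ∧
    (α ∉ (C.state 0).tree → (C.state 0).flow α = 0)
  step : ∀ p < gadgetLength i, GadgetStep i (.s i) (.t i) (C.state p) (C.walk p) (C.entering p)
    (C.leaving p) (C.state (p + 1))
  separates : ∀ p ≤ gadgetLength i, ∃ κ, Separates i (C.state p).tree κ
  classified : ∀ p ≤ gadgetLength i, ∀ d : GArc × Bool, d.1 ∈ gadgetArcs i →
    d.1 ∉ (C.state p).tree → 0 < (C.state p).rescap d → C.Classified v r i p d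
  cost_le : ∀ p < gadgetLength i, C.cost v r p ≤ 2 ^ i - 1 + ∑ j ∈ Finset.Icc 1 i, |v j|
  le_cost : ∀ p < gadgetLength i, -∑ j ∈ Finset.Icc 1 i, |v j| ≤ C.cost v r p
  base_step : ∀ k < 2 ^ i, (C.entering (3 * k)).1 = .base ∧ (C.leaving (3 * k)).1 = .base ∧
    (C.state (3 * k)).flow .base = ((k % 2 : ℕ) : ℝ) ∧
    (C.state (3 * k + 1)).flow .base = (((k + 1) % 2 : ℕ) : ℝ) ∧
    C.cost v r (3 * k) = k + signedSum v 0 i k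
  level_step : ∀ k, k + 1 < 2 ^ i → ∃ i' ∈ Set.Icc 1 i,
    (∃ c, k + 1 = 2 ^ (i' - 1) * (2 * c + 1)) ∧
    C.cost v r (3 * k + 1) = k + min r (1 - r) + signedSum v i' i k ∧
    C.cost v r (3 * k + 2) = k + max r (1 - r) + signedSum v i' i k ∧
    ((C.Swaps (3 * k + 1) (.ss i') (.ts i') ∧ C.Swaps (3 * k + 2) (.st i') (.tt i')) ∨
      (C.Swaps (3 * k + 1) (.st i') (.tt i') ∧ C.Swaps (3 * k + 2) (.ss i') (.ts i')))

/-- The run of `S_0`. -/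
def zero : GadgetRun where
  state p := ⟨∅, fun _ => p⟩
  walk _ := [(.base, true)]
  entering _ := (.base, true)
  leaving _ := (.base, true)

theorem isRun_zero (v : ℕ → ℝ) (r : ℝ) : zero.IsRun v r 0 where
  init_tree := by
    rintro α rfl
    simp [zero]
  init_flow := by
    rintro α rfl
    simp [zero]
  step := by
    intro p hp
    obtain rfl : p = 0 := by
      simp [gadgetLength] at hp
      omega
    refine ⟨⟨⟨?_, ?_, ?_, ?_⟩, ?_⟩, ?_, ?_, ?_, ?_, ?_, ?_, ?_, ?_⟩
    · exact ⟨rfl, rfl⟩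
    · simp [zero]
    · simp [zero]
    · simp [zero]
    · simp [zero, gadgetArcs]
    · simp [zero]
    · simp [zero]
    · simp [zero, rescap]
    · simp [zero]
    · simp [zero, rescap, GArc.cap]
    · simp [zero]
    · simp [zero, gadgetArcs]
    · rintro α rfl
      simp [zero, push]
  separates p _ := ⟨{.s 0}, by simp, by simp, by simp [zero]⟩
  classified := by
    rintro p hp ⟨α, b⟩ (rfl : α = .base) - hc
    have hp' : p = 0 ∨ p = 1 := by
      simp [gadgetLength] at hp
      omega
    -- The base arc is empty in state 0 and full in state 1, so each state has a single residual
    -- dart: the step itself, or its undoing.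
    rcases hp' with rfl | rfl <;> rcases b with _ | _ <;> simp [zero, rescap, GArc.cap] at hc
    · refine Or.inl ⟨[(.base, true)], ⟨⟨⟨rfl, rfl⟩, by simp, by simp, by simp⟩, ?_⟩, ?_,
        Or.inl ⟨rfl, rfl⟩⟩
      · simp [gadgetArcs]
      · simp [gadgetLength]
    · refine Or.inr (Or.inl ⟨[(.base, false)], ⟨⟨⟨rfl, rfl⟩, by simp, by simp, by simp⟩, ?_⟩, ?_,
        Or.inl ⟨rfl, ?_⟩⟩)
      · simp [gadgetArcs]
      · simp
      · simp [cost, zero, pathCost, dartCost]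
  cost_le p _ := by simp [cost, zero, pathCost, dartCost, gadgetNet, GArc.cost]
  le_cost p _ := by simp [cost, zero, pathCost, dartCost, gadgetNet, GArc.cost]
  base_step := by
    intro k hk
    obtain rfl : k = 0 := by
      simp at hk
      omega
    simp [cost, zero, pathCost, dartCost, gadgetNet, GArc.cost, signedSum]
  level_step k hk := by
    simp at hk

/-- The arcs that join `S_i` to `s_{i+1}` and `t_{i+1}` before the basis changes there. -/
def outerFirst (p : ℕ) : GadgetState where
  tree := {α | match α with
    | .ss _ | .tt _ => True
    | _ => False}
  flow
    | .ss _ | .tt _ => p + 1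
    | _ => 0

open Classical in
/-- The arcs that join `S_i` to `s_{i+1}` and `t_{i+1}` after one of the two basis changes. -/
noncomputable def outerMid (i : ℕ) (b : Prop) : GadgetState where
  tree := {α | match α with
    | .ss _ | .st _ => ¬b
    | .tt _ | .ts _ => b
    | .base => False}
  flow
    | .ss _ => if b then 3 * 2 ^ i else 3 * 2 ^ i - 1
    | .tt _ => if b then 3 * 2 ^ i - 1 else 3 * 2 ^ i
    | .st _ => if b then 0 else 1
    | .ts _ => if b then 1 else 0
    | .base => 0

/-- The arcs that join `S_i` to `s_{i+1}` and `t_{i+1}` after both basis changes. -/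
def outerLast (i p : ℕ) : GadgetState where
  tree := {α | match α with
    | .st _ | .ts _ => True
    | _ => False}
  flow
    | .ss _ | .tt _ => 3 * 2 ^ i
    | .st _ | .ts _ => p + 1 - 3 * 2 ^ i
    | _ => 0

end GadgetRun

namespace GadgetRun

open Classical in
/-- The run of `S_{i+1}` that is built from the run of `S_i`: the latter is executed, the arcs
that join `S_i` to `s_{i+1}` and `t_{i+1}` are exchanged, and the run of `S_i` is undone. -/
noncomputable def succ (C : GadgetRun) (r : ℝ) (i : ℕ) : GadgetRun where
  state p :=
    if p ≤ gadgetLength i then (C.state p).extend i (outerFirst p)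
    else if p = gadgetLength i + 1 then (C.state (gadgetLength i)).extend i (outerMid i (r < 1 / 2))
    else (C.state (2 * gadgetLength i + 2 - p)).extend i (outerLast i p)
  walk p :=
    if p < gadgetLength i then (.ss (i + 1), true) :: (C.walk p ++ [(.tt (i + 1), true)])
    else if p = gadgetLength i then
      if r < 1 / 2 then [(.ss (i + 1), true), (.ts (i + 1), true)]
      else [(.st (i + 1), true), (.tt (i + 1), true)]
    else if p = gadgetLength i + 1 then
      if r < 1 / 2 then [(.st (i + 1), true), (.tt (i + 1), true)]
      else [(.ss (i + 1), true), (.ts (i + 1), true)]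
    else (.st (i + 1), true) ::
      (flipWalk (C.walk (2 * gadgetLength i + 1 - p)) ++ [(.ts (i + 1), true)])
  entering p :=
    if p < gadgetLength i then C.entering p
    else if p = gadgetLength i then
      if r < 1 / 2 then (.ts (i + 1), true) else (.st (i + 1), true)
    else if p = gadgetLength i + 1 then
      if r < 1 / 2 then (.st (i + 1), true) else (.ts (i + 1), true)
    else flipDart (C.leaving (2 * gadgetLength i + 1 - p))
  leaving p :=
    if p < gadgetLength i then C.leaving p
    else if p = gadgetLength i then
      if r < 1 / 2 then (.ss (i + 1), true) else (.tt (i + 1), true)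
    else if p = gadgetLength i + 1 then
      if r < 1 / 2 then (.tt (i + 1), true) else (.ss (i + 1), true)
    else flipDart (C.entering (2 * gadgetLength i + 1 - p))

section

variable (C : GadgetRun) (v : ℕ → ℝ) (r : ℝ) (i : ℕ) {p : ℕ}

theorem succ_state_of_le (hp : p ≤ gadgetLength i) :
    (C.succ r i).state p = (C.state p).extend i (outerFirst p) := by
  simp [succ, hp]

theorem succ_state_mid : (C.succ r i).state (gadgetLength i + 1) =
    (C.state (gadgetLength i)).extend i (outerMid i (r < 1 / 2)) := by
  simp [succ]

theorem succ_state_of_ge (hp : gadgetLength i + 2 ≤ p) : (C.succ r i).state p =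
    (C.state (2 * gadgetLength i + 2 - p)).extend i (outerLast i p) := by
  have h₁ : ¬ p ≤ gadgetLength i := by omega
  have h₂ : p ≠ gadgetLength i + 1 := by omega
  simp [succ, h₁, h₂]

theorem succ_walk_of_lt (hp : p < gadgetLength i) : (C.succ r i).walk p =
    (.ss (i + 1), true) :: (C.walk p ++ [(.tt (i + 1), true)]) := by
  simp [succ, hp]

theorem succ_entering_of_lt (hp : p < gadgetLength i) :
    (C.succ r i).entering p = C.entering p := by
  simp [succ, hp]

theorem succ_leaving_of_lt (hp : p < gadgetLength i) :
    (C.succ r i).leaving p = C.leaving p := by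
  simp [succ, hp]

theorem succ_walk_of_ge (hp : gadgetLength i + 2 ≤ p) : (C.succ r i).walk p =
    (.st (i + 1), true) ::
      (flipWalk (C.walk (2 * gadgetLength i + 1 - p)) ++ [(.ts (i + 1), true)]) := by
  have h₁ : ¬ p < gadgetLength i := by omega
  have h₂ : p ≠ gadgetLength i := by omega
  have h₃ : p ≠ gadgetLength i + 1 := by omega
  simp [succ, h₁, h₂, h₃]

theorem succ_entering_of_ge (hp : gadgetLength i + 2 ≤ p) :
    (C.succ r i).entering p = flipDart (C.leaving (2 * gadgetLength i + 1 - p)) := by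
  have h₁ : ¬ p < gadgetLength i := by omega
  have h₂ : p ≠ gadgetLength i := by omega
  have h₃ : p ≠ gadgetLength i + 1 := by omega
  simp [succ, h₁, h₂, h₃]

theorem succ_leaving_of_ge (hp : gadgetLength i + 2 ≤ p) :
    (C.succ r i).leaving p = flipDart (C.entering (2 * gadgetLength i + 1 - p)) := by
  have h₁ : ¬ p < gadgetLength i := by omega
  have h₂ : p ≠ gadgetLength i := by omega
  have h₃ : p ≠ gadgetLength i + 1 := by omega
  simp [succ, h₁, h₂, h₃]

theorem succ_cost_of_lt (hp : p < gadgetLength i) :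
    (C.succ r i).cost v r p = C.cost v r p + v (i + 1) := by
  simp only [cost, succ_walk_of_lt C r i hp, pathCost_cons, pathCost_append, pathCost_nil]
  simp only [dartCost, gadgetNet, GArc.cost]
  ring

theorem succ_cost_of_ge (hp : gadgetLength i + 2 ≤ p) : (C.succ r i).cost v r p =
    2 ^ (i + 1) - 1 - v (i + 1) - C.cost v r (2 * gadgetLength i + 1 - p) := by
  simp only [cost, succ_walk_of_ge C r i hp, pathCost_cons, pathCost_append, pathCost_nil,
    pathCost_flipWalk]
  simp only [dartCost, gadgetNet, GArc.cost, Nat.add_sub_cancel]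
  ring

theorem succ_cost_mid₁ : (C.succ r i).cost v r (gadgetLength i) =
    2 ^ i - 1 + min r (1 - r) := by
  by_cases h : r < 1 / 2
  · rw [min_eq_left (by linarith)]
    simp only [cost, succ, lt_irrefl, if_true, if_false, h, pathCost_cons, pathCost_nil]
    simp only [dartCost, gadgetNet, GArc.cost, Nat.add_sub_cancel]
    ring
  · rw [min_eq_right (by linarith)]
    simp only [cost, succ, lt_irrefl, if_true, if_false, h, pathCost_cons, pathCost_nil]
    simp only [dartCost, gadgetNet, GArc.cost, Nat.add_sub_cancel]
    ring

theorem succ_cost_mid₂ : (C.succ r i).cost v r (gadgetLength i + 1) =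
    2 ^ i - 1 + max r (1 - r) := by
  by_cases h : r < 1 / 2
  · rw [max_eq_right (by linarith)]
    simp only [cost, succ, Nat.succ_ne_self, not_lt.2 (Nat.le_succ _), if_true, if_false,
      h, pathCost_cons, pathCost_nil]
    simp only [dartCost, gadgetNet, GArc.cost, Nat.add_sub_cancel]
    ring
  · rw [max_eq_left (by linarith)]
    simp only [cost, succ, Nat.succ_ne_self, not_lt.2 (Nat.le_succ _), if_true, if_false,
      h, pathCost_cons, pathCost_nil]
    simp only [dartCost, gadgetNet, GArc.cost, Nat.add_sub_cancel]
    ring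

end

theorem mem_gadgetArcs_of_level_ne {i : ℕ} {α : GArc} (hα : α ∈ gadgetArcs (i + 1))
    (hi : α.level ≠ i + 1) : α ∈ gadgetArcs i := by
  rcases hα with hα | rfl | rfl | rfl | rfl
  · exact hα
  all_goals exact absurd rfl hi

/-- A step that only concerns the arcs that are in `S_{i+1}` but not in `S_i`. -/
theorem gadgetStep_of_level {i : ℕ} {a b : GNode} {X L L' : GadgetState}
    {w : List (GArc × Bool)} {δ l : GArc × Bool} (hw : ∀ e ∈ w, e.1.level = i + 1)
    (h : (gadgetNet 0 0).IsThread L.tree a b δ w)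
    (notMem_tree : δ.1 ∉ L.tree) (leaving_mem : l ∈ w)
    (rescap_entering : L.rescap δ = δ.1.cap) (rescap_lt : ∀ e ∈ w, e ≠ δ → L.rescap e < e.1.cap)
    (rescap_leaving : L.rescap l = 1) (one_lt_rescap : ∀ e ∈ w, e ≠ l → 1 < L.rescap e)
    (tree_eq : ∀ α, α.level = i + 1 → (α ∈ L'.tree ↔ (α = δ.1 ∨ α ∈ L.tree) ∧ α ≠ l.1))
    (flow_eq : ∀ α, α.level = i + 1 → L'.flow α = push L.flow 1 w α) :
    GadgetStep (i + 1) a b (X.extend i L) w δ l (X.extend i L') where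
  walk := h.walk
  nodup := h.nodup
  mem := h.mem
  tree e he hne := (mem_tree_extend_of_level (hw e he)).2 (h.tree e he hne)
  arcs e he := mem_gadgetArcs_of_level (hw e he)
  notMem_tree := by rwa [mem_tree_extend_of_level (hw δ h.mem)]
  leaving_mem := leaving_mem
  rescap_entering := by rwa [rescap_extend_of_level (hw δ h.mem)]
  rescap_lt e he hne := by
    rw [rescap_extend_of_level (hw e he)]
    exact rescap_lt e he hne
  rescap_leaving := by rwa [rescap_extend_of_level (hw l leaving_mem)]
  one_lt_rescap e he hne := by
    rw [rescap_extend_of_level (hw e he)]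
    exact one_lt_rescap e he hne
  tree_eq α hα := by
    by_cases hi : α.level = i + 1
    · rw [mem_tree_extend_of_level hi, mem_tree_extend_of_level hi, tree_eq α hi]
    · have hα' := mem_gadgetArcs_of_level_ne hα hi
      have h₁ : α ≠ δ.1 := by
        rintro rfl
        exact hi (hw _ h.mem)
      have h₂ : α ≠ l.1 := by
        rintro rfl
        exact hi (hw _ leaving_mem)
      rw [mem_tree_extend_of_mem hα', mem_tree_extend_of_mem hα']
      simp [h₁, h₂]
  flow_eq α hα := by
    by_cases hi : α.level = i + 1
    · rw [flow_extend_of_level hi, flow_eq α hi]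
      exact push_congr (flow_extend_of_level hi).symm fun c => Iff.rfl
    · have hα' := mem_gadgetArcs_of_level_ne hα hi
      rw [flow_extend_of_mem hα', push_of_notMem, flow_extend_of_mem hα']
      rintro e he rfl
      exact hi (hw e he)

theorem three_le_pow (i : ℕ) : (3 : ℝ) ≤ 3 * 2 ^ i := by
  have : (1 : ℝ) ≤ 2 ^ i := one_le_pow₀ (by norm_num)
  linarith

namespace IsRun

variable {C : GadgetRun} {v : ℕ → ℝ} {r : ℝ} {i p : ℕ}

/-- The outer arcs carry the initial unit and one more per step, `p + 1` in all. Their residual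
capacity 3·2^i − (p + 1) exceeds 1 exactly when `p < gadgetLength i`, so they are never the
bottleneck in this phase. -/
theorem succ_step_of_lt (h : C.IsRun v r i) (hp : p < gadgetLength i) :
    GadgetStep (i + 1) (.s (i + 1)) (.t (i + 1)) ((C.succ r i).state p) ((C.succ r i).walk p)
      ((C.succ r i).entering p) ((C.succ r i).leaving p) ((C.succ r i).state (p + 1)) := by
  rw [succ_state_of_le C r i hp.le, succ_state_of_le C r i hp, succ_walk_of_lt C r i hp,
    succ_entering_of_lt C r i hp, succ_leaving_of_lt C r i hp]
  have hE := cast_gadgetLength i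
  have hp' : (p : ℝ) + 1 ≤ gadgetLength i := by exact_mod_cast hp
  have hp₀ : (0 : ℝ) < p + 1 := by positivity
  refine (h.step p hp).extend trivial trivial (by simp) rfl rfl rfl rfl rfl rfl ?_ ?_ ?_ ?_ ?_ ?_
  · simp [rescap, outerFirst, GArc.cap]
    linarith
  · simp [rescap, outerFirst, GArc.cap]
    linarith
  · simp [rescap, outerFirst, GArc.cap]
    linarith
  · simp [rescap, outerFirst, GArc.cap]
    linarith
  · exact fun α _ => Iff.rfl
  · rintro (_ | _ | _ | _ | _) hα <;> simp [GArc.level] at hα <;> subst hα <;>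
      simp [push, outerFirst]

/-- A reversed step of S_i goes from t_i to s_i, which fits between `st (i+1)` and `ts (i+1)`. Both
of these carried one unit after the exchanges; they could become tight only after the last step. -/
theorem succ_step_of_ge (h : C.IsRun v r i) (hp : gadgetLength i + 2 ≤ p)
    (hp' : p < gadgetLength (i + 1)) :
    GadgetStep (i + 1) (.s (i + 1)) (.t (i + 1)) ((C.succ r i).state p) ((C.succ r i).walk p)
      ((C.succ r i).entering p) ((C.succ r i).leaving p) ((C.succ r i).state (p + 1)) := by
  rw [succ_state_of_ge C r i hp, succ_state_of_ge C r i (hp.trans (Nat.le_succ p)),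
    succ_walk_of_ge C r i hp, succ_entering_of_ge C r i hp, succ_leaving_of_ge C r i hp]
  rw [gadgetLength_succ] at hp'
  obtain ⟨q, hq⟩ : ∃ q, 2 * gadgetLength i + 1 = p + q := ⟨2 * gadgetLength i + 1 - p, by omega⟩
  rw [show 2 * gadgetLength i + 2 - p = q + 1 by omega,
    show 2 * gadgetLength i + 2 - (p + 1) = q by omega,
    show 2 * gadgetLength i + 1 - p = q by omega]
  have hE := cast_gadgetLength i
  have h₁ : (gadgetLength i : ℝ) + 2 ≤ p := by exact_mod_cast hp
  have h₂ : (p : ℝ) < 2 * gadgetLength i + 2 := by exact_mod_cast hp'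
  refine (h.step q (by omega)).symm.extend trivial trivial (by simp) rfl rfl rfl rfl rfl rfl
    ?_ ?_ ?_ ?_ ?_ ?_
  · simp [rescap, outerLast, GArc.cap]
    linarith
  · simp [rescap, outerLast, GArc.cap]
    linarith
  · simp [rescap, outerLast, GArc.cap]
    linarith
  · simp [rescap, outerLast, GArc.cap]
    linarith
  · exact fun α _ => Iff.rfl
  · rintro (_ | _ | _ | _ | _) hα <;> simp [GArc.level] at hα <;> subst hα <;>
      simp [push, outerLast] <;> ring

/-- Here `ss` and `tt` carry 3·2^i − 1 units. The unit that is sent saturates the one on the cheaper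
path, which leaves the basis in favour of the empty diagonal arc on that path. -/
theorem succ_step_mid₁ :
    GadgetStep (i + 1) (.s (i + 1)) (.t (i + 1)) ((C.succ r i).state (gadgetLength i))
      ((C.succ r i).walk (gadgetLength i)) ((C.succ r i).entering (gadgetLength i))
      ((C.succ r i).leaving (gadgetLength i)) ((C.succ r i).state (gadgetLength i + 1)) := by
  rw [succ_state_of_le C r i le_rfl, succ_state_mid]
  have hE := cast_gadgetLength i
  have h3 := three_le_pow i
  by_cases hr : r < 1 / 2
  all_goals
    simp only [succ, lt_irrefl, if_true, if_false, hr]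
    refine gadgetStep_of_level ?_ ⟨⟨rfl, rfl, rfl⟩, ?_, ?_, ?_⟩ ?_ ?_ ?_ ?_ ?_ ?_ ?_ ?_
    · simp [GArc.level]
    · simp
    · simp
    · simp [outerFirst]
    · simp [outerFirst]
    · simp
    · simp [rescap, outerFirst, GArc.cap]
    · simp [rescap, outerFirst, GArc.cap]
      linarith
    · simp [rescap, outerFirst, GArc.cap]
      linarith
    · simp [rescap, outerFirst, GArc.cap]
      linarith
    · rintro (_ | _ | _ | _ | _) hα <;> simp [GArc.level] at hα <;> subst hα <;>
        simp [outerFirst, outerMid]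
    · rintro (_ | _ | _ | _ | _) hα <;> simp [GArc.level] at hα <;> subst hα <;>
        simp [push, outerFirst, outerMid] <;> linarith

theorem succ_step_mid₂ :
    GadgetStep (i + 1) (.s (i + 1)) (.t (i + 1)) ((C.succ r i).state (gadgetLength i + 1))
      ((C.succ r i).walk (gadgetLength i + 1)) ((C.succ r i).entering (gadgetLength i + 1))
      ((C.succ r i).leaving (gadgetLength i + 1)) ((C.succ r i).state (gadgetLength i + 2)) := by
  rw [succ_state_of_ge C r i le_rfl, succ_state_mid,
    show 2 * gadgetLength i + 2 - (gadgetLength i + 2) = gadgetLength i by omega]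
  have hE := cast_gadgetLength i
  have h3 := three_le_pow i
  by_cases hr : r < 1 / 2
  all_goals
    simp only [succ, if_true, if_false, hr, Nat.succ_ne_self, not_lt.2 (Nat.le_succ _)]
    refine gadgetStep_of_level ?_ ⟨⟨rfl, rfl, rfl⟩, ?_, ?_, ?_⟩ ?_ ?_ ?_ ?_ ?_ ?_ ?_ ?_
    · simp [GArc.level]
    · simp
    · simp
    · simp [outerMid]
    · simp [outerMid]
    · simp
    · simp [rescap, outerMid, GArc.cap]
    · simp [rescap, outerMid, GArc.cap]
      try linarith
    · simp [rescap, outerMid, GArc.cap]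
    · simp [rescap, outerMid, GArc.cap]
      linarith
    · rintro (_ | _ | _ | _ | _) hα <;> simp [GArc.level] at hα <;> subst hα <;>
        simp [outerLast, outerMid]
    · rintro (_ | _ | _ | _ | _) hα <;> simp [GArc.level] at hα <;> subst hα <;>
        simp [push, outerLast, outerMid] <;> linarith

theorem succ_step (h : C.IsRun v r i) (hp : p < gadgetLength (i + 1)) :
    GadgetStep (i + 1) (.s (i + 1)) (.t (i + 1)) ((C.succ r i).state p) ((C.succ r i).walk p)
      ((C.succ r i).entering p) ((C.succ r i).leaving p) ((C.succ r i).state (p + 1)) := by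
  rcases lt_trichotomy p (gadgetLength i) with hlt | rfl | hgt
  · exact h.succ_step_of_lt hlt
  · exact succ_step_mid₁
  · rcases Nat.lt_or_ge p (gadgetLength i + 2) with hlt | hge
    · obtain rfl : p = gadgetLength i + 1 := by omega
      exact succ_step_mid₂
    · exact h.succ_step_of_ge hge hp

end IsRun

end GadgetRun

/-! ### Binary digits and the costs of the steps -/

theorem signedSum_succ (v : ℕ → ℝ) {a i : ℕ} (h : a ≤ i) (k : ℕ) :
    signedSum v a (i + 1) k = signedSum v a i k + (-1) ^ (k / 2 ^ i % 2) * v (i + 1) := by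
  unfold signedSum
  rw [← Finset.insert_Ioc_right_eq_Ioc_add_one h, Finset.sum_insert (by simp), add_comm,
    Nat.add_sub_cancel]

theorem signedSum_eq_neg (v : ℕ → ℝ) {a i k k' : ℕ}
    (h : ∀ j, a ≤ j → j < i → k / 2 ^ j % 2 ≠ k' / 2 ^ j % 2) :
    signedSum v a i k = -signedSum v a i k' := by
  unfold signedSum
  rw [← Finset.sum_neg_distrib]
  refine Finset.sum_congr rfl fun j hj => ?_
  rw [Finset.mem_Ioc] at hj
  have := h (j - 1) (by omega) (by omega)
  rcases Nat.mod_two_eq_zero_or_one (k / 2 ^ (j - 1)) with h₁ | h₁ <;>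
    rcases Nat.mod_two_eq_zero_or_one (k' / 2 ^ (j - 1)) with h₂ | h₂ <;>
    rw [h₁, h₂] at this ⊢ <;> first | exact absurd rfl this | simp

/-- The lower bits of `2 ^ i - 1 - c` are the negated bits of `c`. -/
theorem div_mod_ne_of_add_eq {c d i j m : ℕ} (h : c + d + 1 = 2 ^ i * m) (hj : j < i) :
    c / 2 ^ j % 2 ≠ d / 2 ^ j % 2 := by
  obtain ⟨e, rfl⟩ : ∃ e, i = j + e + 1 := ⟨i - j - 1, by omega⟩
  have hpos : 0 < 2 ^ j := by positivity
  have h₁ := Nat.div_add_mod c (2 ^ j)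
  have h₂ := Nat.div_add_mod d (2 ^ j)
  have h₃ := Nat.mod_lt c hpos
  have h₄ := Nat.mod_lt d hpos
  set x := c / 2 ^ j
  set y := d / 2 ^ j
  have h₅ : 2 ^ (j + e + 1) * m = 2 ^ j * (2 * (2 ^ e * m)) := by ring
  rw [h₅] at h
  -- The two remainders plus 1 lie strictly between 0 and 2·2^j, and their sum is a multiple of 2^j,
  -- hence equal to 2^j. So `x + y` is odd.
  have h₆ : x + y + 1 = 2 * (2 ^ e * m) := by
    have h₇ : 2 ^ j * (x + y) < 2 ^ j * (2 * (2 ^ e * m)) := by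
      rw [mul_add]
      omega
    have h₈ : 2 ^ j * (2 * (2 ^ e * m)) < 2 ^ j * (x + y + 2) := by
      rw [mul_add, mul_add]
      omega
    have := Nat.lt_of_mul_lt_mul_left h₇
    have := Nat.lt_of_mul_lt_mul_left h₈
    omega
  omega

namespace GadgetRun.IsRun

variable {C : GadgetRun} {v : ℕ → ℝ} {r : ℝ} {i p : ℕ}

theorem sum_Icc_abs_succ (v : ℕ → ℝ) (i : ℕ) :
    ∑ j ∈ Finset.Icc 1 (i + 1), |v j| = ∑ j ∈ Finset.Icc 1 i, |v j| + |v (i + 1)| :=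
  Finset.sum_Icc_succ_top (by omega) _

/-- In the last phase, `q` is the step of the smaller run that step `p` undoes. -/
theorem exists_position (p : ℕ) (i : ℕ) (hp : p < gadgetLength (i + 1)) :
    p < gadgetLength i ∨ p = gadgetLength i ∨ p = gadgetLength i + 1 ∨
      ∃ q < gadgetLength i, p + q = 2 * gadgetLength i + 1 := by
  rw [gadgetLength_succ] at hp
  by_cases h : p < gadgetLength i + 2
  · omega
  · exact Or.inr (Or.inr (Or.inr ⟨2 * gadgetLength i + 1 - p, by omega, by omega⟩))

theorem succ_cost_of_add_eq (C : GadgetRun) (v : ℕ → ℝ) (r : ℝ) {q : ℕ}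
    (hq : q < gadgetLength i) (hpq : p + q = 2 * gadgetLength i + 1) :
    (C.succ r i).cost v r p = 2 ^ (i + 1) - 1 - v (i + 1) - C.cost v r q := by
  rw [succ_cost_of_ge C v r i (by omega), show 2 * gadgetLength i + 1 - p = q by omega]

/-- The undone steps enter with a negative sign, so the upper bound needs the lower bound of the
smaller run, and conversely; both bounds are carried through the induction. -/
theorem succ_cost_le (h : C.IsRun v r i) (hr₀ : 0 ≤ r) (hr₁ : r ≤ 1)
    (hp : p < gadgetLength (i + 1)) :
    (C.succ r i).cost v r p ≤ 2 ^ (i + 1) - 1 + ∑ j ∈ Finset.Icc 1 (i + 1), |v j| := by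
  rw [sum_Icc_abs_succ]
  have hB : 0 ≤ ∑ j ∈ Finset.Icc 1 i, |v j| := Finset.sum_nonneg fun _ _ => abs_nonneg _
  have h₁ := le_abs_self (v (i + 1))
  have h₂ := neg_abs_le (v (i + 1))
  have h₃ : (1 : ℝ) ≤ 2 ^ i := one_le_pow₀ (by norm_num)
  rw [pow_succ]
  rcases exists_position p i hp with hlt | rfl | rfl | ⟨q, hq, hpq⟩
  · rw [succ_cost_of_lt C v r i hlt]
    linarith [h.cost_le p hlt]
  · rw [succ_cost_mid₁]
    linarith [min_le_left r (1 - r)]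
  · rw [succ_cost_mid₂]
    have : max r (1 - r) ≤ 1 := max_le hr₁ (by linarith)
    linarith
  · rw [succ_cost_of_add_eq C v r hq hpq, pow_succ]
    linarith [h.le_cost q hq]

theorem succ_le_cost (h : C.IsRun v r i) (hr₀ : 0 ≤ r) (hr₁ : r ≤ 1)
    (hp : p < gadgetLength (i + 1)) :
    -∑ j ∈ Finset.Icc 1 (i + 1), |v j| ≤ (C.succ r i).cost v r p := by
  rw [sum_Icc_abs_succ]
  have hB : 0 ≤ ∑ j ∈ Finset.Icc 1 i, |v j| := Finset.sum_nonneg fun _ _ => abs_nonneg _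
  have h₁ := le_abs_self (v (i + 1))
  have h₂ := neg_abs_le (v (i + 1))
  have h₃ : (1 : ℝ) ≤ 2 ^ i := one_le_pow₀ (by norm_num)
  rcases exists_position p i hp with hlt | rfl | rfl | ⟨q, hq, hpq⟩
  · rw [succ_cost_of_lt C v r i hlt]
    linarith [h.le_cost p hlt]
  · rw [succ_cost_mid₁]
    have : 0 ≤ min r (1 - r) := le_min hr₀ (by linarith)
    linarith
  · rw [succ_cost_mid₂]
    linarith [le_max_left r (1 - r)]
  · rw [succ_cost_of_add_eq C v r hq hpq, pow_succ]
    linarith [h.cost_le q hq]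

theorem succ_base_step (h : C.IsRun v r i) {k : ℕ} (hk : k < 2 ^ (i + 1)) :
    ((C.succ r i).entering (3 * k)).1 = .base ∧ ((C.succ r i).leaving (3 * k)).1 = .base ∧
    ((C.succ r i).state (3 * k)).flow .base = ((k % 2 : ℕ) : ℝ) ∧
    ((C.succ r i).state (3 * k + 1)).flow .base = (((k + 1) % 2 : ℕ) : ℝ) ∧
    (C.succ r i).cost v r (3 * k) = k + signedSum v 0 (i + 1) k := by
  have hE := gadgetLength_add_two i
  rw [signedSum_succ v (Nat.zero_le i)]
  rcases Nat.lt_or_ge k (2 ^ i) with hlt | hge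
  · obtain ⟨h₁, h₂, h₃, h₄, h₅⟩ := h.base_step k hlt
    have hp : 3 * k < gadgetLength i := by omega
    rw [succ_entering_of_lt C r i hp, succ_leaving_of_lt C r i hp, succ_state_of_le C r i hp.le,
      succ_state_of_le C r i hp, succ_cost_of_lt C v r i hp,
      flow_extend_of_mem (base_mem_gadgetArcs i), flow_extend_of_mem (base_mem_gadgetArcs i),
      Nat.div_eq_of_lt hlt]
    refine ⟨h₁, h₂, h₃, h₄, ?_⟩
    rw [h₅]
    simp
    ring
  · rw [pow_succ] at hk
    -- Iteration 3k undoes iteration 3l, as 3k + 3l = 2 · `gadgetLength i` + 1. Entering and leaving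
    -- arcs are exchanged, and the lower `i` digits of `k` and `l` are complementary.
    obtain ⟨l, hl⟩ : ∃ l, k + l + 1 = 2 ^ i * 2 := ⟨2 ^ i * 2 - 1 - k, by omega⟩
    have hl' : l < 2 ^ i := by omega
    obtain ⟨h₁, h₂, h₃, h₄, h₅⟩ := h.base_step l hl'
    have hp : gadgetLength i + 2 ≤ 3 * k := by omega
    have hq : 3 * l < gadgetLength i := by omega
    have hpq : 3 * k + 3 * l = 2 * gadgetLength i + 1 := by omega
    have hpar : (k + 1) % 2 = l % 2 ∧ (l + 1) % 2 = k % 2 := by omega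
    have hdiv : k / 2 ^ i = 1 := Nat.div_eq_of_lt_le (by omega) (by omega)
    rw [succ_entering_of_ge C r i hp, succ_leaving_of_ge C r i hp, succ_state_of_ge C r i hp,
      succ_state_of_ge C r i (hp.trans (Nat.le_succ _)), succ_cost_of_add_eq C v r hq hpq,
      flow_extend_of_mem (base_mem_gadgetArcs i), flow_extend_of_mem (base_mem_gadgetArcs i),
      show 2 * gadgetLength i + 1 - 3 * k = 3 * l by omega,
      show 2 * gadgetLength i + 2 - 3 * k = 3 * l + 1 by omega,
      show 2 * gadgetLength i + 2 - (3 * k + 1) = 3 * l by omega, hpar.1, ← hpar.2, hdiv]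
    refine ⟨h₂, h₁, h₄, h₃, ?_⟩
    rw [h₅, signedSum_eq_neg v (k := l) (k' := k)
      fun j _ hj => div_mod_ne_of_add_eq (m := 2) (by omega) hj]
    have : (k : ℝ) + l + 1 = 2 ^ i * 2 := by exact_mod_cast hl
    rw [pow_succ]
    simp
    linarith

theorem succ_swaps_of_lt (hp : p < gadgetLength i) {α β : GArc} :
    (C.succ r i).Swaps p α β ↔ C.Swaps p α β := by
  rw [Swaps, Swaps, succ_entering_of_lt C r i hp, succ_leaving_of_lt C r i hp]

theorem succ_swaps_of_add_eq {q : ℕ} (hq : q < gadgetLength i)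
    (hpq : p + q = 2 * gadgetLength i + 1) {α β : GArc} :
    (C.succ r i).Swaps p α β ↔ C.Swaps q α β := by
  have hp : gadgetLength i + 2 ≤ p := by omega
  rw [Swaps, Swaps, succ_entering_of_ge C r i hp, succ_leaving_of_ge C r i hp,
    show 2 * gadgetLength i + 1 - p = q by omega]
  simp only [flipDart]
  tauto

/-- The index `i'` is the position of the lowest zero digit of `k`, counted from 1; this is what the
odd factor of `k + 1` records. It is carried along because the reflection here is `k + l + 2 =
2^(i+1)`, for which only the digits above that position are known to be complementary. -/
theorem succ_level_step (h : C.IsRun v r i) {k : ℕ} (hk : k + 1 < 2 ^ (i + 1)) :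
    ∃ i' ∈ Set.Icc 1 (i + 1), (∃ c, k + 1 = 2 ^ (i' - 1) * (2 * c + 1)) ∧
    (C.succ r i).cost v r (3 * k + 1) = k + min r (1 - r) + signedSum v i' (i + 1) k ∧
    (C.succ r i).cost v r (3 * k + 2) = k + max r (1 - r) + signedSum v i' (i + 1) k ∧
    (((C.succ r i).Swaps (3 * k + 1) (.ss i') (.ts i') ∧
        (C.succ r i).Swaps (3 * k + 2) (.st i') (.tt i')) ∨
      ((C.succ r i).Swaps (3 * k + 1) (.st i') (.tt i') ∧
        (C.succ r i).Swaps (3 * k + 2) (.ss i') (.ts i'))) := by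
  have hE := gadgetLength_add_two i
  rcases Nat.lt_trichotomy (k + 1) (2 ^ i) with hlt | heq | hgt
  · obtain ⟨i', ⟨hi₁, hi₂⟩, hc, h₁, h₂, h₃⟩ := h.level_step k hlt
    have hp₁ : 3 * k + 1 < gadgetLength i := by omega
    have hp₂ : 3 * k + 2 < gadgetLength i := by omega
    refine ⟨i', ⟨hi₁, by omega⟩, hc, ?_, ?_, ?_⟩
    · rw [succ_cost_of_lt C v r i hp₁, h₁, signedSum_succ v hi₂, Nat.div_eq_of_lt (by omega)]
      simp
      ring
    · rw [succ_cost_of_lt C v r i hp₂, h₂, signedSum_succ v hi₂, Nat.div_eq_of_lt (by omega)]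
      simp
      ring
    · simpa only [succ_swaps_of_lt hp₁, succ_swaps_of_lt hp₂] using h₃
  · have hp₁ : 3 * k + 1 = gadgetLength i := by omega
    have hp₂ : 3 * k + 2 = gadgetLength i + 1 := by omega
    have hk' : (k : ℝ) + 1 = 2 ^ i := by exact_mod_cast heq
    refine ⟨i + 1, ⟨by omega, le_rfl⟩, ⟨0, by simpa using heq⟩, ?_, ?_, ?_⟩
    · rw [hp₁, succ_cost_mid₁, ← hk']
      simp [signedSum]
    · rw [hp₂, succ_cost_mid₂, ← hk']
      simp [signedSum]
    · rw [hp₁, hp₂]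
      by_cases hr : r < 1 / 2
      · left
        constructor <;> simp only [Swaps, succ, lt_irrefl, Nat.succ_ne_self,
          not_lt.2 (Nat.le_succ _), if_true, if_false, hr] <;> simp
      · right
        constructor <;> simp only [Swaps, succ, lt_irrefl, Nat.succ_ne_self,
          not_lt.2 (Nat.le_succ _), if_true, if_false, hr] <;> simp
  · rw [pow_succ] at hk
    obtain ⟨l, hl⟩ : ∃ l, k + l + 2 = 2 ^ i * 2 := ⟨2 ^ i * 2 - 2 - k, by omega⟩
    obtain ⟨i', ⟨hi₁, hi₂⟩, ⟨c, hc⟩, h₁, h₂, h₃⟩ := h.level_step l (by omega)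
    have hq₁ : 3 * l + 1 < gadgetLength i := by omega
    have hq₂ : 3 * l + 2 < gadgetLength i := by omega
    -- Undoing reverses the order within a pair: 3k + 1 undoes 3l + 2, and 3k + 2 undoes 3l + 1.
    have hpq₁ : 3 * k + 1 + (3 * l + 2) = 2 * gadgetLength i + 1 := by omega
    have hpq₂ : 3 * k + 2 + (3 * l + 1) = 2 * gadgetLength i + 1 := by omega
    have hdiv : k / 2 ^ i = 1 := Nat.div_eq_of_lt_le (by omega) (by omega)
    have hl' : (k : ℝ) + l + 2 = 2 ^ i * 2 := by exact_mod_cast hl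
    obtain ⟨e, rfl⟩ : ∃ e, i = i' + e := ⟨i - i', by omega⟩
    obtain ⟨f, rfl⟩ : ∃ f, i' = f + 1 := ⟨i' - 1, by omega⟩
    rw [Nat.add_sub_cancel] at hc
    have hpos : 0 < 2 ^ f := by positivity
    have hpow : 2 ^ (f + 1 + e) * 2 = 2 ^ f * (4 * 2 ^ e) := by ring
    obtain ⟨d, hd⟩ : ∃ d, c + d + 1 = 2 ^ e * 2 := by
      refine ⟨2 ^ e * 2 - 1 - c, ?_⟩
      have : 2 ^ f * (2 * c + 1) < 2 ^ f * (4 * 2 ^ e) := by omega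
      have := Nat.lt_of_mul_lt_mul_left this
      omega
    have hkd : k + 1 = 2 ^ f * (2 * d + 1) := by
      have : 2 ^ f * (4 * 2 ^ e) = 2 ^ f * (2 * c + 1) + 2 ^ f * (2 * d + 1) := by
        rw [← mul_add]
        congr 1
        omega
      omega
    have hquot : ∀ {k d : ℕ}, k + 1 = 2 ^ f * (2 * d + 1) → k / 2 ^ (f + 1) = d := by
      intro k d hkd
      rw [pow_succ]
      have h₁ : 2 ^ f * (2 * d + 1) = d * (2 ^ f * 2) + 2 ^ f := by ring
      refine Nat.div_eq_of_lt_le ?_ ?_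
      · omega
      · rw [add_mul]
        omega
    have hneg : signedSum v (f + 1) (f + 1 + e) l = -signedSum v (f + 1) (f + 1 + e) k := by
      refine signedSum_eq_neg v fun j hj₁ hj₂ => ?_
      obtain ⟨g, rfl⟩ : ∃ g, j = f + 1 + g := ⟨j - (f + 1), by omega⟩
      rw [pow_add 2 (f + 1) g, ← Nat.div_div_eq_div_mul, ← Nat.div_div_eq_div_mul, hquot hc,
        hquot hkd]
      exact div_mod_ne_of_add_eq hd (by omega)
    refine ⟨f + 1, ⟨by omega, by omega⟩, ⟨d, by simpa using hkd⟩, ?_, ?_, ?_⟩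
    · rw [succ_cost_of_add_eq C v r hq₂ hpq₁, h₂, signedSum_succ v (by omega), hdiv, hneg, pow_succ]
      -- Since `min r (1 - r)` and `max r (1 - r)` add up to 1, subtracting the larger cost of the
      -- undone pair yields the smaller one here.
      have := min_add_max r (1 - r)
      simp
      linarith
    · rw [succ_cost_of_add_eq C v r hq₁ hpq₂, h₁, signedSum_succ v (by omega), hdiv, hneg, pow_succ]
      have := min_add_max r (1 - r)
      simp
      linarith
    · simp only [succ_swaps_of_add_eq hq₂ hpq₁, succ_swaps_of_add_eq hq₁ hpq₂]
      tauto

theorem succ_init_tree (h : C.IsRun v r i) {α : GArc} (hα : α ∈ gadgetArcs (i + 1)) :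
    α ∈ ((C.succ r i).state 0).tree ↔ ∃ j, α = .ss j ∨ α = .tt j := by
  rw [succ_state_of_le C r i (Nat.zero_le _)]
  by_cases hi : α.level = i + 1
  · rw [mem_tree_extend_of_level hi]
    rcases α with _ | _ | _ | _ | _ <;> simp [outerFirst]
  · have hα' := mem_gadgetArcs_of_level_ne hα hi
    rw [mem_tree_extend_of_mem hα', h.init_tree α hα']

theorem succ_init_flow (h : C.IsRun v r i) {α : GArc} (hα : α ∈ gadgetArcs (i + 1)) :
    (α ∈ ((C.succ r i).state 0).tree → ((C.succ r i).state 0).flow α = 1) ∧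
      (α ∉ ((C.succ r i).state 0).tree → ((C.succ r i).state 0).flow α = 0) := by
  rw [succ_state_of_le C r i (Nat.zero_le _)]
  by_cases hi : α.level = i + 1
  · rw [mem_tree_extend_of_level hi, flow_extend_of_level hi]
    rcases α with _ | _ | _ | _ | _ <;> simp [outerFirst]
  · have hα' := mem_gadgetArcs_of_level_ne hα hi
    rw [mem_tree_extend_of_mem hα', flow_extend_of_mem hα']
    exact h.init_flow α hα'

end GadgetRun.IsRun

/-! ### Separation of s_i from t_i, and classification of the possible entering darts -/

@[simp]
theorem GadgetState.ss_mem_tree_extend (i : ℕ) (X L : GadgetState) :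
    GArc.ss (i + 1) ∈ (X.extend i L).tree ↔ GArc.ss (i + 1) ∈ L.tree :=
  mem_tree_extend_of_level rfl

@[simp]
theorem GadgetState.tt_mem_tree_extend (i : ℕ) (X L : GadgetState) :
    GArc.tt (i + 1) ∈ (X.extend i L).tree ↔ GArc.tt (i + 1) ∈ L.tree :=
  mem_tree_extend_of_level rfl

@[simp]
theorem GadgetState.st_mem_tree_extend (i : ℕ) (X L : GadgetState) :
    GArc.st (i + 1) ∈ (X.extend i L).tree ↔ GArc.st (i + 1) ∈ L.tree :=
  mem_tree_extend_of_level rfl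

@[simp]
theorem GadgetState.ts_mem_tree_extend (i : ℕ) (X L : GadgetState) :
    GArc.ts (i + 1) ∈ (X.extend i L).tree ↔ GArc.ts (i + 1) ∈ L.tree :=
  mem_tree_extend_of_level rfl

theorem GadgetThread.mono {i : ℕ} {T T' : Set GArc} {a b : GNode} {d : GArc × Bool}
    {w : List (GArc × Bool)} (h : GadgetThread i T a b d w)
    (hT : ∀ α ∈ gadgetArcs i, α ∈ T → α ∈ T') : GadgetThread i T' a b d w where
  walk := h.walk
  nodup := h.nodup
  mem := h.mem
  tree e he hne := hT _ (h.arcs e he) (h.tree e he hne)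
  arcs := h.arcs

/-- Extending a separating set: `κ` contains the nodes of `S_i` that are joined to `s_{i+1}`. -/
theorem separates_succ {i : ℕ} {T : Set GArc} {κ : Set GNode}
    (h : ∀ α ∈ gadgetArcs i, α ∈ T → (α.src ∈ κ ↔ α.tgt ∈ κ))
    (hss : .ss (i + 1) ∈ T → .s i ∈ κ) (htt : .tt (i + 1) ∈ T → .t i ∉ κ)
    (hst : .st (i + 1) ∈ T → .t i ∈ κ) (hts : .ts (i + 1) ∈ T → .s i ∉ κ) :
    Separates (i + 1) T {β | β = .s (i + 1) ∨ β ≠ .t (i + 1) ∧ β ∈ κ} where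
  s_mem := by simp
  t_notMem := by simp
  src_iff_tgt := by
    rintro α (hα | rfl | rfl | rfl | rfl) hT
    · have hs := src_mem_gadgetNodes hα
      have ht := tgt_mem_gadgetNodes hα
      have h₁ : ∀ β ∈ gadgetNodes i, β ≠ .s (i + 1) ∧ β ≠ .t (i + 1) := by
        intro β hβ
        constructor <;> rintro rfl
        · have := s_mem_gadgetNodes.1 hβ
          omega
        · have := t_mem_gadgetNodes.1 hβ
          omega
      simp [h₁ _ hs, h₁ _ ht, h α hα hT]
    · simp [GArc.src, GArc.tgt, hss hT]
    · simp [GArc.src, GArc.tgt, htt hT]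
    · simp [GArc.src, GArc.tgt, hst hT]
    · simp [GArc.src, GArc.tgt, hts hT]

namespace GadgetRun.IsRun

variable {C : GadgetRun} {v : ℕ → ℝ} {r : ℝ} {i p : ℕ}

theorem succ_state_cases (C : GadgetRun) (r : ℝ) (hp : p ≤ gadgetLength (i + 1)) :
    (p ≤ gadgetLength i ∧ (C.succ r i).state p = (C.state p).extend i (outerFirst p)) ∨
    (p = gadgetLength i + 1 ∧ (C.succ r i).state p =
      (C.state (gadgetLength i)).extend i (outerMid i (r < 1 / 2))) ∨
    ∃ q ≤ gadgetLength i, p + q = 2 * gadgetLength i + 2 ∧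
      (C.succ r i).state p = (C.state q).extend i (outerLast i p) := by
  rw [gadgetLength_succ] at hp
  rcases Nat.lt_trichotomy p (gadgetLength i + 1) with hlt | rfl | hgt
  · exact Or.inl ⟨by omega, succ_state_of_le C r i (by omega)⟩
  · exact Or.inr (Or.inl ⟨rfl, succ_state_mid C r i⟩)
  · exact Or.inr (Or.inr ⟨2 * gadgetLength i + 2 - p, by omega, by omega,
      succ_state_of_ge C r i hgt⟩)

/-- In the first phase s_{i+1} is attached to s_i, and the old cut is kept. Between the two
exchanges both s_i and t_i are attached to the same outer node, so all of S_i lies on one side. In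
the last phase s_{i+1} is attached to t_i, and the cut is complemented. -/
theorem succ_separates (h : C.IsRun v r i) (hp : p ≤ gadgetLength (i + 1)) :
    ∃ κ, Separates (i + 1) ((C.succ r i).state p).tree κ := by
  rcases succ_state_cases C r hp with ⟨hle, hs⟩ | ⟨rfl, hs⟩ | ⟨q, hq, hpq, hs⟩ <;> rw [hs]
  · obtain ⟨κ, hκ⟩ := h.separates p hle
    refine ⟨_, separates_succ (κ := κ) ?_ ?_ ?_ ?_ ?_⟩
    · exact fun α hα hT => hκ.src_iff_tgt α hα ((mem_tree_extend_of_mem hα).1 hT)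
    · exact fun _ => hκ.s_mem
    · exact fun _ => hκ.t_notMem
    · intro hT
      rw [mem_tree_extend_of_level rfl] at hT
      exact hT.elim
    · intro hT
      rw [mem_tree_extend_of_level rfl] at hT
      exact hT.elim
  · by_cases hr : r < 1 / 2
    · refine ⟨_, separates_succ (κ := ∅) ?_ ?_ ?_ ?_ ?_⟩ <;>
        simp [outerMid, hr, -one_div]
    · refine ⟨_, separates_succ (κ := Set.univ) ?_ ?_ ?_ ?_ ?_⟩ <;>
        simp [outerMid, hr, -one_div]
  · obtain ⟨κ, hκ⟩ := h.separates q hq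
    refine ⟨_, separates_succ (κ := κᶜ) ?_ ?_ ?_ ?_ ?_⟩
    · exact fun α hα hT => not_congr (hκ.src_iff_tgt α hα ((mem_tree_extend_of_mem hα).1 hT))
    · intro hT
      rw [mem_tree_extend_of_level rfl] at hT
      exact hT.elim
    · intro hT
      rw [mem_tree_extend_of_level rfl] at hT
      exact hT.elim
    · exact fun _ => hκ.t_notMem
    · exact fun _ hs => hs hκ.s_mem

theorem classified_entering {δ l : GArc × Bool} {X' : GadgetState}
    (h : GadgetStep i (.s i) (.t i) (C.state p) (C.walk p) δ l X')
    (hδ : δ = C.entering p) (hp : p < gadgetLength i) : C.Classified v r i p δ :=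
  Or.inl ⟨_, h.toGadgetThread, hp, Or.inl ⟨hδ, rfl⟩⟩

theorem classified_undo {δ l : GArc × Bool} {X : GadgetState}
    (h : GadgetStep i (.s i) (.t i) X (C.walk p) δ l (C.state (p + 1)))
    (hl : l = C.leaving p) : C.Classified v r i (p + 1) (flipDart l) := by
  refine Or.inr (Or.inl ⟨_, h.symm.toGadgetThread, p.succ_pos, Or.inl ⟨?_, ?_⟩⟩)
  · rw [hl, Nat.add_sub_cancel]
  · rw [pathCost_flipWalk, Nat.add_sub_cancel]
    rfl

theorem isTreePath_mono {V E : Type*} {G : Network V E} {T T' : Set E} {a b : V}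
    {w : List (E × Bool)} (h : G.IsTreePath T a b w) (hT : ∀ e ∈ w, e.1 ∈ T → e.1 ∈ T') :
    G.IsTreePath T' a b w :=
  ⟨h.1, h.2.1, fun e he => hT e he (h.2.2 e he)⟩

theorem level_cases {d : GArc × Bool} (hd : d.1.level = i + 1) :
    d.1 = .ss (i + 1) ∨ d.1 = .tt (i + 1) ∨ d.1 = .st (i + 1) ∨ d.1 = .ts (i + 1) := by
  rcases d with ⟨_ | _ | _ | _ | _, b⟩ <;> simp [GArc.level] at hd ⊢ <;> exact hd

/-- Threads of S_i in either direction are prolonged by `ss` and `tt`, which shifts all forward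
costs by v_{i+1} and all backward costs by −v_{i+1}, so comparisons persist. The new competitors are
the empty arcs `st` and `ts`. -/
theorem succ_classified_first (h : C.IsRun v r i)
    (hr : ∑ j ∈ Finset.Icc 1 (i + 1), |v j| < r) (hr' : ∑ j ∈ Finset.Icc 1 (i + 1), |v j| < 1 - r)
    (hr₂ : r ≠ 1 / 2) (hp : p ≤ gadgetLength i) {d : GArc × Bool} (hd : d.1 ∈ gadgetArcs (i + 1))
    (hdT : d.1 ∉ ((C.succ r i).state p).tree) (hdc : 0 < ((C.succ r i).state p).rescap d) :
    (C.succ r i).Classified v r (i + 1) p d := by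
  have hlen : p < gadgetLength (i + 1) := by
    rw [gadgetLength_succ]
    omega
  have hs := succ_state_of_le C r i hp
  rw [sum_Icc_abs_succ] at hr hr'
  have hv := le_abs_self (v (i + 1))
  have hv' := neg_abs_le (v (i + 1))
  rw [hs] at hdT hdc
  by_cases hi : d.1.level = i + 1
  · rw [mem_tree_extend_of_level hi] at hdT
    rw [rescap_extend_of_level hi] at hdc
    -- While S_i runs, a step costs at most 2^i − 1 + Σ|v_j|, the sum now including |v_{i+1}|. Being
    -- smaller than r and 1 − r, the sum keeps this below the costs of both diagonal paths.
    have hE : p = gadgetLength i ∨ p < gadgetLength i ∧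
        (C.succ r i).cost v r p < 2 ^ i - (1 - r) ∧ (C.succ r i).cost v r p < 2 ^ i - r := by
      rcases hp.eq_or_lt with hp | hp
      · exact Or.inl hp
      · refine Or.inr ⟨hp, ?_⟩
        rw [succ_cost_of_lt C v r i hp]
        have := h.cost_le p hp
        constructor <;> linarith
    rcases d with ⟨α, b⟩
    rcases level_cases hi with h₁ | h₁ | h₁ | h₁ <;> obtain rfl : α = _ := h₁
    · exact absurd trivial hdT
    · exact absurd trivial hdT
    · rcases b with _ | _
      · exact absurd hdc (lt_irrefl _)
      · by_cases hent : p = gadgetLength i ∧ ¬ r < 1 / 2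
        · obtain ⟨rfl, hlt⟩ := hent
          have he : (GArc.st (i + 1), true) = (C.succ r i).entering (gadgetLength i) := by
            simp only [succ, lt_irrefl, if_true, if_false, hlt]
          rw [he]
          exact classified_entering succ_step_mid₁ rfl hlen
        · refine Or.inl ⟨[(.st (i + 1), true), (.tt (i + 1), true)],
            ⟨⟨⟨rfl, rfl, rfl⟩, by simp, by simp, ?_⟩, ?_⟩, hlen, Or.inr ?_⟩
          · simp [hs, outerFirst]
          · simp [gadgetArcs]
          · have hw : (gadgetNet v r).pathCost [(.st (i + 1), true), (.tt (i + 1), true)] =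
                2 ^ i - r := by
              simp [pathCost, dartCost, gadgetNet, GArc.cost]
            rw [hw]
            rcases hE with rfl | ⟨-, -, hE⟩
            · rw [succ_cost_mid₁]
              have : r < 1 / 2 := by tauto
              linarith [min_le_left r (1 - r)]
            · exact hE
    · rcases b with _ | _
      · exact absurd hdc (lt_irrefl _)
      · by_cases hent : p = gadgetLength i ∧ r < 1 / 2
        · obtain ⟨rfl, hlt⟩ := hent
          have he : (GArc.ts (i + 1), true) = (C.succ r i).entering (gadgetLength i) := by
            simp only [succ, lt_irrefl, if_true, if_false, hlt]
          rw [he]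
          exact classified_entering succ_step_mid₁ rfl hlen
        · refine Or.inl ⟨[(.ss (i + 1), true), (.ts (i + 1), true)],
            ⟨⟨⟨rfl, rfl, rfl⟩, by simp, by simp, ?_⟩, ?_⟩, hlen, Or.inr ?_⟩
          · simp [hs, outerFirst]
          · simp [gadgetArcs]
          · have hw : (gadgetNet v r).pathCost [(.ss (i + 1), true), (.ts (i + 1), true)] =
                2 ^ i - (1 - r) := by
              simp [pathCost, dartCost, gadgetNet, GArc.cost]
            rw [hw]
            rcases hE with rfl | ⟨-, hE, -⟩
            · rw [succ_cost_mid₁]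
              -- Strictness at the exchange needs r ≠ 1/2; otherwise both diagonal paths would tie.
              have : 1 / 2 < r := lt_of_le_of_ne (not_lt.1 fun hh => hent ⟨rfl, hh⟩) hr₂.symm
              linarith [min_le_right r (1 - r)]
            · exact hE
  · have hd' := mem_gadgetArcs_of_level_ne hd hi
    rw [mem_tree_extend_of_mem hd'] at hdT
    rw [rescap_extend_of_mem hd'] at hdc
    have hT : ∀ α ∈ gadgetArcs i, α ∈ (C.state p).tree → α ∈ ((C.succ r i).state p).tree := by
      intro α hα hα'
      rwa [hs, mem_tree_extend_of_mem hα]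
    have hss : GArc.ss (i + 1) ∈ ((C.succ r i).state p).tree := by
      rw [hs, mem_tree_extend_of_level rfl]
      trivial
    have htt : GArc.tt (i + 1) ∈ ((C.succ r i).state p).tree := by
      rw [hs, mem_tree_extend_of_level rfl]
      trivial
    rcases h.classified p hp d hd' hdT hdc with ⟨w, hw, hp', hwc⟩ | ⟨w, hw, hp', hwc⟩ |
      ⟨w, hw, hwi, hwc⟩
    · refine Or.inl ⟨_, hw.extend (x := (.ss (i + 1), true)) (y := (.tt (i + 1), true)) hT hss htt
        (by simp) rfl rfl rfl rfl rfl rfl, hlen, ?_⟩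
      have hc : (gadgetNet v r).pathCost ((.ss (i + 1), true) :: (w ++ [(.tt (i + 1), true)])) =
          (gadgetNet v r).pathCost w + v (i + 1) := by
        simp only [pathCost_cons, pathCost_append, pathCost_nil]
        simp only [dartCost, gadgetNet, GArc.cost]
        ring
      rw [succ_entering_of_lt C r i hp', succ_cost_of_lt C v r i hp', hc]
      simpa using hwc
    · refine Or.inr (Or.inl ⟨_, hw.extend (x := (.tt (i + 1), false)) (y := (.ss (i + 1), false))
        hT htt hss (by simp) rfl rfl rfl rfl rfl rfl, hp', ?_⟩)
      have hc : (gadgetNet v r).pathCost ((.tt (i + 1), false) :: (w ++ [(.ss (i + 1), false)])) =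
          (gadgetNet v r).pathCost w - v (i + 1) := by
        simp only [pathCost_cons, pathCost_append, pathCost_nil]
        simp only [dartCost, gadgetNet, GArc.cost]
        ring
      have hp'' : p - 1 < gadgetLength i := by omega
      rw [succ_leaving_of_lt C r i hp'', succ_cost_of_lt C v r i hp'', hc]
      rcases hwc with ⟨h₁, h₂⟩ | h₁
      · exact Or.inl ⟨h₁, by linarith⟩
      · exact Or.inr (by linarith)
    · exact Or.inr (Or.inr ⟨w, isTreePath_mono hw fun e he => hT _ (hwi e he),
        fun e he => gadgetArcs_mono_succ i (hwi e he), hwc⟩)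

/-- The outer arcs offer only the second exchange and the undoing of the first. As S_i is in its
final state, its forward threads are excluded; its backward threads no longer reach both outer nodes
and close cycles inside S_{i+1}. -/
theorem succ_classified_mid (h : C.IsRun v r i)
    (hr : ∑ j ∈ Finset.Icc 1 (i + 1), |v j| < r) (hr' : ∑ j ∈ Finset.Icc 1 (i + 1), |v j| < 1 - r)
    {d : GArc × Bool} (hd : d.1 ∈ gadgetArcs (i + 1))
    (hdT : d.1 ∉ ((C.succ r i).state (gadgetLength i + 1)).tree)
    (hdc : 0 < ((C.succ r i).state (gadgetLength i + 1)).rescap d) :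
    (C.succ r i).Classified v r (i + 1) (gadgetLength i + 1) d := by
  have hlen : gadgetLength i + 1 < gadgetLength (i + 1) := by
    rw [gadgetLength_succ]
    omega
  have hs := succ_state_mid C r i
  have hs₂ := succ_step_mid₂ (C := C) (r := r) (i := i)
  have hs₁ := succ_step_mid₁ (C := C) (r := r) (i := i)
  rw [sum_Icc_abs_succ] at hr hr'
  have hv := le_abs_self (v (i + 1))
  have hv' := neg_abs_le (v (i + 1))
  by_cases hi : d.1.level = i + 1
  · rw [hs, mem_tree_extend_of_level hi] at hdT
    rw [hs, rescap_extend_of_level hi] at hdc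
    have hd₂ : d = (C.succ r i).entering (gadgetLength i + 1) ∨
        d = flipDart ((C.succ r i).leaving (gadgetLength i)) := by
      rcases d with ⟨α, b⟩
      by_cases hlt : r < 1 / 2
      all_goals
        simp only [succ, lt_irrefl, Nat.succ_ne_self, not_lt.2 (Nat.le_succ _), if_true, if_false,
          hlt, flipDart]
        simp only [hlt] at hdT hdc
        rcases level_cases hi with h₁ | h₁ | h₁ | h₁ <;> obtain rfl : α = _ := h₁ <;>
          rcases b with _ | _ <;> simp [outerMid, rescap, GArc.cap] at hdT hdc ⊢
    rcases hd₂ with rfl | rfl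
    · exact classified_entering hs₂ rfl hlen
    · exact classified_undo hs₁ rfl
  · have hd' := mem_gadgetArcs_of_level_ne hd hi
    rw [hs, mem_tree_extend_of_mem hd'] at hdT
    rw [hs, rescap_extend_of_mem hd'] at hdc
    have hT : ∀ α ∈ gadgetArcs i, α ∈ (C.state (gadgetLength i)).tree →
        α ∈ ((C.succ r i).state (gadgetLength i + 1)).tree := by
      intro α hα hα'
      rwa [hs, mem_tree_extend_of_mem hα]
    rcases h.classified _ le_rfl d hd' hdT hdc with ⟨w, hw, hp', hwc⟩ | ⟨w, hw, hp', hwc⟩ |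
      ⟨w, hw, hwi, hwc⟩
    · exact absurd hp' (lt_irrefl _)
    · have hc : -C.cost v r (gadgetLength i - 1) ≤ (gadgetNet v r).pathCost w := by
        rcases hwc with ⟨-, h₁⟩ | h₁ <;> linarith
      have hb := h.cost_le (gadgetLength i - 1) (by omega)
      -- The outer detour from s_i to t_i, over t_{i+1} or s_{i+1}, costs 2^i − 1 + r − v_{i+1} or
      -- 2^i − r − v_{i+1}. This is at least the maximal cost of a step of S_i, so the cycle has
      -- nonnegative cost.
      obtain ⟨q, hq, hqi, hqc⟩ : ∃ q, (gadgetNet 0 0).IsTreePath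
          ((C.succ r i).state (gadgetLength i + 1)).tree (.s i) (.t i) q ∧
          (∀ e ∈ q, e.1.level = i + 1) ∧
          2 ^ i - 1 + ∑ j ∈ Finset.Icc 1 i, |v j| ≤ (gadgetNet v r).pathCost q := by
        by_cases hlt : r < 1 / 2
        · refine ⟨[(.ts (i + 1), true), (.tt (i + 1), false)], ⟨⟨rfl, rfl, rfl⟩, ?_, ?_⟩, ?_, ?_⟩
          · simp
          · simp only [hs, hlt]
            simp [outerMid]
          · simp [GArc.level]
          · simp [pathCost, dartCost, gadgetNet, GArc.cost]
            linarith
        · refine ⟨[(.ss (i + 1), false), (.st (i + 1), true)], ⟨⟨rfl, rfl, rfl⟩, ?_, ?_⟩, ?_, ?_⟩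
          · simp
          · simp only [hs, hlt]
            simp [outerMid]
          · simp [GArc.level]
          · simp [pathCost, dartCost, gadgetNet, GArc.cost]
            linarith
      obtain ⟨p₁, p₂, rfl, hp⟩ := (hw.mono hT).close hq fun e he f hf hef =>
        level_ne_of_mem_gadgetArcs (hw.arcs e he) (hef ▸ hqi f hf)
      refine Or.inr (Or.inr ⟨_, hp, ?_, ?_⟩)
      · intro e he
        simp only [List.mem_append] at he
        rcases he with (he | he) | he
        · exact gadgetArcs_mono_succ i (hw.arcs e (by simp [he]))
        · exact mem_gadgetArcs_of_level (hqi e he)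
        · exact gadgetArcs_mono_succ i (hw.arcs e (by simp [he]))
      · simp only [pathCost_append, pathCost_cons] at hc ⊢
        linarith
    · exact Or.inr (Or.inr ⟨w, isTreePath_mono hw fun e he => hT _ (hwi e he),
        fun e he => gadgetArcs_mono_succ i (hwi e he), hwc⟩)

/-- The two directions exchange roles: a forward thread of S_i becomes a backward one of S_{i+1},
and undoing a step of S_i becomes the next step. This is where the backward half of the invariant
for S_i is needed. -/
theorem succ_classified_last (h : C.IsRun v r i)
    (hr : ∑ j ∈ Finset.Icc 1 (i + 1), |v j| < r) (hr' : ∑ j ∈ Finset.Icc 1 (i + 1), |v j| < 1 - r)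
    (hr₂ : r ≠ 1 / 2) {q : ℕ} (hq : q ≤ gadgetLength i) (hpq : p + q = 2 * gadgetLength i + 2)
    {d : GArc × Bool} (hd : d.1 ∈ gadgetArcs (i + 1))
    (hdT : d.1 ∉ ((C.succ r i).state p).tree) (hdc : 0 < ((C.succ r i).state p).rescap d) :
    (C.succ r i).Classified v r (i + 1) p d := by
  have hlen := gadgetLength_succ i
  have hs := succ_state_of_ge C r i (p := p) (by omega)
  rw [show 2 * gadgetLength i + 2 - p = q by omega] at hs
  rw [sum_Icc_abs_succ] at hr hr'
  have hv := le_abs_self (v (i + 1))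
  have hv' := neg_abs_le (v (i + 1))
  have hs₂ := succ_step_mid₂ (C := C) (r := r) (i := i)
  rw [hs] at hdT hdc
  -- The step before state `p` undid step `q` of S_i, provided that `p` is not the first state of
  -- this phase.
  have hlast : ∀ hlt : q < gadgetLength i, (C.succ r i).cost v r (p - 1) =
      2 ^ (i + 1) - 1 - v (i + 1) - C.cost v r q := fun hlt =>
    succ_cost_of_add_eq C v r hlt (by omega)
  by_cases hi : d.1.level = i + 1
  · rw [mem_tree_extend_of_level hi] at hdT
    rw [rescap_extend_of_level hi] at hdc
    -- Each undoing step costs at least 2^i − Σ|v_j|, the sum now including |v_{i+1}|. This exceeds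
    -- the costs of both saturated outer paths, so taking one of them back is dearer than undoing
    -- the last step.
    have hE : q = gadgetLength i ∨
        2 ^ i - (1 - r) < (C.succ r i).cost v r (p - 1) ∧
          2 ^ i - r < (C.succ r i).cost v r (p - 1) := by
      rcases hq.eq_or_lt with hq | hq
      · exact Or.inl hq
      · refine Or.inr ?_
        rw [hlast hq, pow_succ]
        have := h.cost_le q hq
        constructor <;> linarith
    rcases d with ⟨α, b⟩
    rcases level_cases hi with h₁ | h₁ | h₁ | h₁ <;> obtain rfl : α = _ := h₁
    · rcases b with _ | _
      swap
      · simp [rescap, outerLast, GArc.cap] at hdc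
      · by_cases hent : q = gadgetLength i ∧ ¬ r < 1 / 2
        · obtain ⟨rfl, hlt⟩ := hent
          obtain rfl : p = gadgetLength i + 2 := by omega
          have he : (GArc.ss (i + 1), false) =
              flipDart ((C.succ r i).leaving (gadgetLength i + 1)) := by
            simp [succ, hlt, flipDart, -one_div]
          rw [he]
          exact classified_undo hs₂ rfl
        · refine Or.inr (Or.inl ⟨[(.ts (i + 1), false), (.ss (i + 1), false)],
            ⟨⟨⟨rfl, rfl, rfl⟩, by simp, by simp, ?_⟩, ?_⟩, by omega, Or.inr ?_⟩)
          · simp [hs, outerLast]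
          · simp [gadgetArcs]
          · have hw : (gadgetNet v r).pathCost [(.ts (i + 1), false), (.ss (i + 1), false)] =
                -(2 ^ i - (1 - r)) := by
              simp [pathCost, dartCost, gadgetNet, GArc.cost]
              ring
            rw [hw, neg_lt_neg_iff]
            rcases hE with rfl | ⟨hE, -⟩
            · rw [show p - 1 = gadgetLength i + 1 by omega, succ_cost_mid₂]
              have : r < 1 / 2 := by tauto
              linarith [le_max_right r (1 - r)]
            · exact hE
    · rcases b with _ | _
      swap
      · simp [rescap, outerLast, GArc.cap] at hdc
      · by_cases hent : q = gadgetLength i ∧ r < 1 / 2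
        · obtain ⟨rfl, hlt⟩ := hent
          obtain rfl : p = gadgetLength i + 2 := by omega
          have he : (GArc.tt (i + 1), false) =
              flipDart ((C.succ r i).leaving (gadgetLength i + 1)) := by
            simp [succ, hlt, flipDart, -one_div]
          rw [he]
          exact classified_undo hs₂ rfl
        · refine Or.inr (Or.inl ⟨[(.tt (i + 1), false), (.st (i + 1), false)],
            ⟨⟨⟨rfl, rfl, rfl⟩, by simp, by simp, ?_⟩, ?_⟩, by omega, Or.inr ?_⟩)
          · simp [hs, outerLast]
          · simp [gadgetArcs]
          · have hw : (gadgetNet v r).pathCost [(.tt (i + 1), false), (.st (i + 1), false)] =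
                -(2 ^ i - r) := by
              simp [pathCost, dartCost, gadgetNet, GArc.cost]
              ring
            rw [hw, neg_lt_neg_iff]
            rcases hE with rfl | ⟨-, hE⟩
            · rw [show p - 1 = gadgetLength i + 1 by omega, succ_cost_mid₂]
              have : 1 / 2 < r := lt_of_le_of_ne (not_lt.1 fun hh => hent ⟨rfl, hh⟩) hr₂.symm
              linarith [le_max_left r (1 - r)]
            · exact hE
    · exact absurd trivial hdT
    · exact absurd trivial hdT
  · have hd' := mem_gadgetArcs_of_level_ne hd hi
    rw [mem_tree_extend_of_mem hd'] at hdT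
    rw [rescap_extend_of_mem hd'] at hdc
    have hT : ∀ α ∈ gadgetArcs i, α ∈ (C.state q).tree → α ∈ ((C.succ r i).state p).tree := by
      intro α hα hα'
      rwa [hs, mem_tree_extend_of_mem hα]
    have hst : GArc.st (i + 1) ∈ ((C.succ r i).state p).tree := by
      rw [hs, mem_tree_extend_of_level rfl]
      trivial
    have hts : GArc.ts (i + 1) ∈ ((C.succ r i).state p).tree := by
      rw [hs, mem_tree_extend_of_level rfl]
      trivial
    rcases h.classified q hq d hd' hdT hdc with ⟨w, hw, hq', hwc⟩ | ⟨w, hw, hq', hwc⟩ |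
      ⟨w, hw, hwi, hwc⟩
    · refine Or.inr (Or.inl ⟨_, hw.extend (x := (.ts (i + 1), false)) (y := (.st (i + 1), false))
        hT hts hst (by simp) rfl rfl rfl rfl rfl rfl, by omega, ?_⟩)
      have hc : (gadgetNet v r).pathCost ((.ts (i + 1), false) :: (w ++ [(.st (i + 1), false)])) =
          (gadgetNet v r).pathCost w - (2 ^ (i + 1) - 1 - v (i + 1)) := by
        simp only [pathCost_cons, pathCost_append, pathCost_nil]
        simp only [dartCost, gadgetNet, GArc.cost, Nat.add_sub_cancel]
        ring
      rw [hlast hq', hc, succ_leaving_of_ge C r i (by omega),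
        show 2 * gadgetLength i + 1 - (p - 1) = q by omega, flipDart_flipDart]
      rcases hwc with ⟨h₁, h₂⟩ | h₁
      · exact Or.inl ⟨h₁, by linarith⟩
      · exact Or.inr (by linarith)
    · refine Or.inl ⟨_, hw.extend (x := (.st (i + 1), true)) (y := (.ts (i + 1), true)) hT hst hts
        (by simp) rfl rfl rfl rfl rfl rfl, by omega, ?_⟩
      have hc : (gadgetNet v r).pathCost ((.st (i + 1), true) :: (w ++ [(.ts (i + 1), true)])) =
          (gadgetNet v r).pathCost w + (2 ^ (i + 1) - 1 - v (i + 1)) := by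
        simp only [pathCost_cons, pathCost_append, pathCost_nil]
        simp only [dartCost, gadgetNet, GArc.cost, Nat.add_sub_cancel]
        ring
      rw [succ_cost_of_add_eq C v r (q := q - 1) (by omega) (by omega), hc,
        succ_entering_of_ge C r i (by omega),
        show 2 * gadgetLength i + 1 - p = q - 1 by omega]
      rcases hwc with ⟨h₁, h₂⟩ | h₁
      · exact Or.inl ⟨h₁, by linarith⟩
      · exact Or.inr (by linarith)
    · exact Or.inr (Or.inr ⟨w, isTreePath_mono hw fun e he => hT _ (hwi e he),
        fun e he => gadgetArcs_mono_succ i (hwi e he), hwc⟩)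

theorem isRun_succ (h : C.IsRun v r i)
    (hr : ∑ j ∈ Finset.Icc 1 (i + 1), |v j| < r) (hr' : ∑ j ∈ Finset.Icc 1 (i + 1), |v j| < 1 - r)
    (hr₂ : r ≠ 1 / 2) : (C.succ r i).IsRun v r (i + 1) := by
  have hB : 0 ≤ ∑ j ∈ Finset.Icc 1 (i + 1), |v j| := Finset.sum_nonneg fun _ _ => abs_nonneg _
  refine ⟨fun α hα => h.succ_init_tree hα, fun α hα => h.succ_init_flow hα,
    fun p hp => h.succ_step hp, fun p hp => h.succ_separates hp, ?_,
    fun p hp => h.succ_cost_le (by linarith) (by linarith) hp,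
    fun p hp => h.succ_le_cost (by linarith) (by linarith) hp,
    fun k hk => h.succ_base_step hk, fun k hk => h.succ_level_step hk⟩
  intro p hp d hd hdT hdc
  rcases succ_state_cases C r hp with ⟨hle, -⟩ | ⟨rfl, -⟩ | ⟨q, hq, hpq, -⟩
  · exact h.succ_classified_first hr hr' hr₂ hle hd hdT hdc
  · exact h.succ_classified_mid hr hr' hd hdT hdc
  · exact h.succ_classified_last hr hr' hr₂ hq hpq hd hdT hdc

end GadgetRun.IsRun

/-- Each gadget has a run. -/
theorem exists_isRun (v : ℕ → ℝ) (r : ℝ) (i : ℕ) (hr : ∑ j ∈ Finset.Icc 1 i, |v j| < r)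
    (hr' : ∑ j ∈ Finset.Icc 1 i, |v j| < 1 - r) (hr₂ : r ≠ 1 / 2) :
    ∃ C : GadgetRun, C.IsRun v r i := by
  induction i with
  | zero => exact ⟨_, GadgetRun.isRun_zero v r⟩
  | succ i ih =>
    have hB := GadgetRun.IsRun.sum_Icc_abs_succ v i
    have hv := abs_nonneg (v (i + 1))
    obtain ⟨C, hC⟩ := ih (by linarith) (by linarith)
    exact ⟨_, hC.isRun_succ hr hr' hr₂⟩

/-! ### Cycles and reduced costs in the whole network -/

namespace Network.BasicSolution

variable {V E : Type*} [Fintype E] {G : Network V E} {x y : G.BasicSolution}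

theorem nodup_cycle (x : G.BasicSolution) {d : E × Bool} (hd : d.1 ∉ x.tree) :
    ((x.cycle d).map Prod.fst).Nodup := by
  have h := x.isTreePath_treePath (G.head d) (G.tail d)
  rw [cycle, List.map_cons, List.nodup_cons]
  refine ⟨?_, h.2.1⟩
  rintro h'
  obtain ⟨e, he, he'⟩ := List.mem_map.1 h'
  exact hd (he' ▸ h.2.2 e he)

/-- The cycle that is closed by the dart of a thread. -/
theorem cycle_eq_of_isThread {a b : V} {d : E × Bool} {w q : List (E × Bool)}
    (h : G.IsThread x.tree a b d w) (hq : G.IsTreePath x.tree b a q)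
    (hwq : ∀ e ∈ w, ∀ f ∈ q, e.1 ≠ f.1) :
    ∃ p₁ p₂, w = p₁ ++ d :: p₂ ∧ x.cycle d = d :: (p₂ ++ q ++ p₁) := by
  obtain ⟨p₁, p₂, hw, hp⟩ := h.close hq hwq
  exact ⟨p₁, p₂, hw, by rw [cycle, ← x.eq_treePath hp]⟩

/-- The fundamental cycle is a rotation of the thread followed by `q`, and cost is invariant under
rotation. -/
theorem reducedCost_eq_of_isThread {a b : V} {d : E × Bool} {w q : List (E × Bool)}
    (h : G.IsThread x.tree a b d w) (hq : G.IsTreePath x.tree b a q)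
    (hwq : ∀ e ∈ w, ∀ f ∈ q, e.1 ≠ f.1) :
    x.reducedCost d = G.pathCost w + G.pathCost q := by
  obtain ⟨p₁, p₂, rfl, hc⟩ := cycle_eq_of_isThread h hq hwq
  rw [reducedCost, hc]
  simp only [pathCost_append, pathCost_cons]
  ring

theorem flow_of_mem_cycle {P : Pivot E} (h : x.IsPivot P y) {d : E × Bool}
    (hd : d ∈ x.cycle P.entering) :
    y.flow d.1 = x.flow d.1 + if d.2 then P.amount else -P.amount := by
  rw [h.flow_eq, push_of_mem (x.nodup_cycle h.candidate.1) hd]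

/-- A dart of the cycle whose residual capacity exceeds the amount of flow that is sent does not
become tight. -/
theorem residual_of_residualGT {P : Pivot E} (h : x.IsPivot P y) {d : E × Bool}
    (hd : d ∈ x.cycle P.entering) {c : ℝ} (hc : P.amount ≤ c) (hres : G.ResidualGT x.flow c d) :
    G.Residual y.flow d := by
  have hf := flow_of_mem_cycle h hd
  rcases d with ⟨e, _ | _⟩
  · simp only [Bool.false_eq_true, if_false] at hf
    change c < x.flow e at hres
    change 0 < y.flow e
    linarith
  · simp only [if_true] at hf
    change ((x.flow e + c : ℝ) : WithTop ℝ) < G.cap e at hres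
    change ((y.flow e + 0 : ℝ) : WithTop ℝ) < G.cap e
    refine lt_of_le_of_lt (WithTop.coe_le_coe.2 ?_) hres
    linarith

end Network.BasicSolution

/-! ### The gadget as a part of the network -/

namespace Gadget

open Network.BasicSolution

variable {V E : Type*} {G : Network V E} {v : ℕ → ℝ} {r : ℝ} {i : ℕ}
  (S : Gadget G v r i)

/-- The dart of the network that corresponds to a dart of the gadget. -/
def dart (d : GArc × Bool) : E × Bool := (S.arc d.1, d.2)

/-- The inner nodes of the gadget. -/
def inner : Set V := S.node '' gadgetInner i

variable {S}

theorem dart_mem_arcs {d : GArc × Bool} (hd : d.1 ∈ gadgetArcs i) : (S.dart d).1 ∈ S.arcs :=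
  ⟨d.1, hd, rfl⟩

theorem exists_dart_eq {e : E × Bool} (he : e.1 ∈ S.arcs) :
    ∃ d : GArc × Bool, d.1 ∈ gadgetArcs i ∧ S.dart d = e := by
  obtain ⟨α, hα, h⟩ := he
  exact ⟨(α, e.2), hα, Prod.ext h rfl⟩

theorem dart_inj {d e : GArc × Bool} (hd : d.1 ∈ gadgetArcs i) (he : e.1 ∈ gadgetArcs i)
    (h : S.dart d = S.dart e) : d = e :=
  Prod.ext (S.arc_injOn hd he (congrArg Prod.fst h)) (congrArg (fun e : E × Bool => e.2) h)

theorem tail_dart {d : GArc × Bool} (hd : d.1 ∈ gadgetArcs i) :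
    G.tail (S.dart d) = S.node ((gadgetNet 0 0).tail d) := by
  rcases d with ⟨α, _ | _⟩
  · exact S.tgt_eq α hd
  · exact S.src_eq α hd

theorem head_dart {d : GArc × Bool} (hd : d.1 ∈ gadgetArcs i) :
    G.head (S.dart d) = S.node ((gadgetNet 0 0).head d) := by
  rcases d with ⟨α, _ | _⟩
  · exact S.src_eq α hd
  · exact S.tgt_eq α hd

theorem tail_mem_gadgetNodes {d : GArc × Bool} (hd : d.1 ∈ gadgetArcs i) :
    (gadgetNet 0 0).tail d ∈ gadgetNodes i := by
  rcases d with ⟨α, _ | _⟩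
  · exact tgt_mem_gadgetNodes hd
  · exact src_mem_gadgetNodes hd

theorem head_mem_gadgetNodes {d : GArc × Bool} (hd : d.1 ∈ gadgetArcs i) :
    (gadgetNet 0 0).head d ∈ gadgetNodes i := by
  rcases d with ⟨α, _ | _⟩
  · exact src_mem_gadgetNodes hd
  · exact tgt_mem_gadgetNodes hd

theorem dartCost_dart {d : GArc × Bool} (hd : d.1 ∈ gadgetArcs i) :
    G.dartCost (S.dart d) = (gadgetNet v r).dartCost d := by
  rcases d with ⟨α, _ | _⟩
  · exact congrArg Neg.neg (S.cost_eq α hd)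
  · exact S.cost_eq α hd

theorem pathCost_map_dart {w : List (GArc × Bool)} (hw : ∀ e ∈ w, e.1 ∈ gadgetArcs i) :
    G.pathCost (w.map S.dart) = (gadgetNet v r).pathCost w := by
  induction w with
  | nil => rfl
  | cons d w ih =>
    rw [List.map_cons, pathCost_cons, pathCost_cons, dartCost_dart (hw d (by simp)),
      ih fun e he => hw e (by simp [he])]

theorem isWalk_map_dart {w : List (GArc × Bool)} (hw : ∀ e ∈ w, e.1 ∈ gadgetArcs i)
    {a b : GNode} (h : (gadgetNet 0 0).IsWalk a b w) :
    G.IsWalk (S.node a) (S.node b) (w.map S.dart) := by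
  induction w generalizing a with
  | nil => exact congrArg S.node h
  | cons d w ih =>
    obtain ⟨h₁, h₂⟩ := h
    have hd := hw d (by simp)
    refine ⟨by rw [tail_dart hd, h₁], ?_⟩
    rw [head_dart hd]
    exact ih (fun e he => hw e (by simp [he])) h₂

theorem nodup_map_dart {w : List (GArc × Bool)} (hw : ∀ e ∈ w, e.1 ∈ gadgetArcs i)
    (h : (w.map Prod.fst).Nodup) : ((w.map S.dart).map Prod.fst).Nodup := by
  have : (w.map S.dart).map Prod.fst = (w.map Prod.fst).map S.arc := by
    simp [dart, Function.comp_def]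
  rw [this]
  refine List.Nodup.map_on ?_ h
  intro α hα β hβ hαβ
  obtain ⟨d, hd, rfl⟩ := List.mem_map.1 hα
  obtain ⟨e, he, rfl⟩ := List.mem_map.1 hβ
  exact S.arc_injOn (hw d hd) (hw e he) hαβ

theorem eq_of_notMem_inner {β : GNode} (hβ : β ∈ gadgetNodes i) (h : S.node β ∉ S.inner) :
    β = .s i ∨ β = .t i := by
  by_contra hne
  exact h ⟨β, ⟨hβ, hne⟩, rfl⟩

theorem node_s_notMem_inner : S.node (.s i) ∉ S.inner := by
  rintro ⟨β, hβ, h⟩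
  obtain rfl := S.node_injOn hβ.1 (s_mem_gadgetNodes.2 le_rfl) h
  exact hβ.2 (Or.inl rfl)

theorem node_t_notMem_inner : S.node (.t i) ∉ S.inner := by
  rintro ⟨β, hβ, h⟩
  obtain rfl := S.node_injOn hβ.1 (t_mem_gadgetNodes.2 le_rfl) h
  exact hβ.2 (Or.inr rfl)

theorem tail_notMem_inner {e : E × Bool} (he : e.1 ∉ S.arcs) : G.tail e ∉ S.inner := by
  rintro ⟨β, hβ, h⟩
  rcases e with ⟨e, _ | _⟩
  · exact he (S.closed e ⟨β, hβ, Or.inr h.symm⟩)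
  · exact he (S.closed e ⟨β, hβ, Or.inl h.symm⟩)

theorem head_notMem_inner {e : E × Bool} (he : e.1 ∉ S.arcs) : G.head e ∉ S.inner := by
  rw [← tail_flipDart]
  exact tail_notMem_inner he

/-- The last part of a walk that ends in the gadget. -/
theorem exists_suffix {u : V} (hu : u ∉ S.inner) (l : List (E × Bool)) {β : GNode}
    (hβ : β ∈ gadgetNodes i) (hl : G.IsWalk u (S.node β) l) :
    ∃ l₁ l₂ a, l = l₁ ++ l₂ ∧ (a = GNode.s i ∨ a = GNode.t i) ∧
      G.IsWalk (S.node a) (S.node β) l₂ ∧ ∀ d ∈ l₂, d.1 ∈ S.arcs := by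
  induction l using List.reverseRecOn generalizing β with
  | nil =>
    obtain rfl : u = S.node β := hl
    exact ⟨[], [], β, rfl, eq_of_notMem_inner hβ hu, rfl, by simp⟩
  | append_singleton l e ih =>
    obtain ⟨m, h₁, rfl, h₂⟩ := isWalk_append.1 hl
    change G.head e = S.node β at h₂
    by_cases he : e.1 ∈ S.arcs
    · obtain ⟨d, hd, rfl⟩ := exists_dart_eq he
      rw [tail_dart hd] at h₁
      obtain ⟨l₁, l₂, a, rfl, ha, hw, hS⟩ := ih (tail_mem_gadgetNodes hd) h₁
      refine ⟨l₁, l₂ ++ [S.dart d], a, by simp, ha, hw.append ⟨tail_dart hd, h₂⟩, ?_⟩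
      intro f hf
      rcases List.mem_append.1 hf with hf | hf
      · exact hS f hf
      · rw [List.mem_singleton] at hf
        rwa [hf]
    · refine ⟨l ++ [e], [], β, by simp, eq_of_notMem_inner (S := S) hβ ?_, rfl, by simp⟩
      rw [← h₂]
      exact head_notMem_inner he

/-- The first part of a walk that starts in the gadget. -/
theorem exists_prefix {u : V} (hu : u ∉ S.inner) (l : List (E × Bool)) {β : GNode}
    (hβ : β ∈ gadgetNodes i) (hl : G.IsWalk (S.node β) u l) :
    ∃ l₁ l₂ a, l = l₁ ++ l₂ ∧ (a = GNode.s i ∨ a = GNode.t i) ∧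
      G.IsWalk (S.node β) (S.node a) l₁ ∧ ∀ d ∈ l₁, d.1 ∈ S.arcs := by
  induction l generalizing β with
  | nil =>
    obtain rfl : S.node β = u := hl
    exact ⟨[], [], β, rfl, eq_of_notMem_inner hβ hu, rfl, by simp⟩
  | cons e l ih =>
    obtain ⟨h₁, h₂⟩ := hl
    by_cases he : e.1 ∈ S.arcs
    · obtain ⟨d, hd, rfl⟩ := exists_dart_eq he
      rw [head_dart hd] at h₂
      obtain ⟨l₁, l₂, a, rfl, ha, hw, hS⟩ := ih (head_mem_gadgetNodes hd) h₂
      refine ⟨S.dart d :: l₁, l₂, a, by simp, ha, ⟨h₁, by rwa [head_dart hd]⟩, ?_⟩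
      intro f hf
      rcases List.mem_cons.1 hf with rfl | hf
      · exact he
      · exact hS f hf
    · refine ⟨[], e :: l, β, by simp, eq_of_notMem_inner (S := S) hβ ?_, rfl, by simp⟩
      rw [← h₁]
      exact tail_notMem_inner he

variable [Fintype E]

variable (S) in
/-- The basis and the flow on the arcs of the gadget are given by the state `X`. -/
structure Matches (x : G.BasicSolution) (X : GadgetState) : Prop where
  mem_tree : ∀ α ∈ gadgetArcs i, S.arc α ∈ x.tree ↔ α ∈ X.tree
  flow_eq : ∀ α ∈ gadgetArcs i, x.flow (S.arc α) = X.flow α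

variable {x y : G.BasicSolution} {X : GadgetState}

theorem Matches.isThread (h : S.Matches x X) {a b : GNode} {d : GArc × Bool}
    {w : List (GArc × Bool)} (hw : GadgetThread i X.tree a b d w) :
    G.IsThread x.tree (S.node a) (S.node b) (S.dart d) (w.map S.dart) where
  walk := isWalk_map_dart hw.arcs hw.walk
  nodup := nodup_map_dart hw.arcs hw.nodup
  mem := List.mem_map.2 ⟨d, hw.mem, rfl⟩
  tree := by
    intro e he hne
    obtain ⟨f, hf, rfl⟩ := List.mem_map.1 he
    exact (h.mem_tree _ (hw.arcs f hf)).2 (hw.tree f hf fun hfd => hne (hfd ▸ rfl))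

theorem Matches.isTreePath (h : S.Matches x X) {a b : GNode} {w : List (GArc × Bool)}
    (hw : (gadgetNet 0 0).IsTreePath X.tree a b w) (hwi : ∀ e ∈ w, e.1 ∈ gadgetArcs i) :
    G.IsTreePath x.tree (S.node a) (S.node b) (w.map S.dart) := by
  refine ⟨isWalk_map_dart hwi hw.1, nodup_map_dart hwi hw.2.1, ?_⟩
  intro e he
  obtain ⟨f, hf, rfl⟩ := List.mem_map.1 he
  exact (h.mem_tree _ (hwi f hf)).2 (hw.2.2 f hf)

theorem Matches.residualGT_iff (h : S.Matches x X) {d : GArc × Bool} (hd : d.1 ∈ gadgetArcs i)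
    (c : ℝ) : G.ResidualGT x.flow c (S.dart d) ↔ c < X.rescap d := by
  rcases d with ⟨α, _ | _⟩
  · change c < x.flow (S.arc α) ↔ c < X.flow α
    rw [h.flow_eq α hd]
  · change ((x.flow (S.arc α) + c : ℝ) : WithTop ℝ) < G.cap (S.arc α) ↔ c < α.cap - X.flow α
    rw [h.flow_eq α hd, S.cap_eq α hd, WithTop.coe_lt_coe, lt_sub_iff_add_lt, add_comm]

theorem Matches.separates (h : S.Matches x X) {κ : Set GNode} (hκ : Separates i X.tree κ)
    {a b : GNode} (ha : a ∈ gadgetNodes i) (hb : b ∈ gadgetNodes i) {p : List (E × Bool)}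
    (hp : G.IsWalk (S.node a) (S.node b) p) (hpS : ∀ d ∈ p, d.1 ∈ S.arcs)
    (hpT : ∀ d ∈ p, d.1 ∈ x.tree) : a ∈ κ ↔ b ∈ κ := by
  induction p generalizing a with
  | nil => rw [S.node_injOn ha hb hp]
  | cons e p ih =>
    obtain ⟨d, hd, rfl⟩ := exists_dart_eq (hpS e (by simp))
    obtain ⟨h₁, h₂⟩ := hp
    rw [tail_dart hd] at h₁
    rw [head_dart hd] at h₂
    obtain rfl := S.node_injOn (tail_mem_gadgetNodes hd) ha h₁
    rw [← ih (head_mem_gadgetNodes hd) h₂ (fun e he => hpS e (by simp [he]))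
      fun e he => hpT e (by simp [he])]
    have := hκ.src_iff_tgt d.1 hd ((h.mem_tree _ hd).1 (hpT (S.dart d) (by simp)))
    rcases d with ⟨α, _ | _⟩
    · exact this.symm
    · exact this

/-- If the basis does not join `s_i` to `t_i` within the gadget, then the tree-paths between nodes
that are not inner nodes of the gadget avoid the gadget. -/
theorem Matches.notMem_arcs (h : S.Matches x X) {κ : Set GNode} (hκ : Separates i X.tree κ)
    {u w : V} (hu : u ∉ S.inner) (hw : w ∉ S.inner) {p : List (E × Bool)}
    (hp : G.IsTreePath x.tree u w p) : ∀ d ∈ p, d.1 ∉ S.arcs := by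
  intro e he heS
  obtain ⟨d, hd, rfl⟩ := exists_dart_eq heS
  obtain ⟨l, l', rfl⟩ := List.append_of_mem he
  obtain ⟨m, h₁, rfl, h₂⟩ := isWalk_append.1 hp.1
  rw [tail_dart hd] at h₁
  rw [head_dart hd] at h₂
  -- Around the dart, a stretch of the path inside the gadget is cut out that begins and ends in s_i
  -- or t_i. By separation both ends coincide, and a nonempty closed trail contradicts uniqueness of
  -- tree-paths.
  obtain ⟨l₁, l₂, a, rfl, ha, hwa, hSa⟩ := exists_suffix hu l (tail_mem_gadgetNodes hd) h₁
  obtain ⟨l₃, l₄, b, rfl, hb, hwb, hSb⟩ := exists_prefix hw l' (head_mem_gadgetNodes hd) h₂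
  have hwalk : G.IsWalk (S.node a) (S.node b) (l₂ ++ S.dart d :: l₃) :=
    hwa.append ⟨tail_dart hd, by rwa [head_dart hd]⟩
  have hsub : (l₂ ++ S.dart d :: l₃).Sublist (l₁ ++ l₂ ++ S.dart d :: (l₃ ++ l₄)) :=
    List.Sublist.append (List.sublist_append_right l₁ l₂)
      (List.Sublist.cons_cons _ (List.sublist_append_left l₃ l₄))
  have htree : G.IsTreePath x.tree (S.node a) (S.node b) (l₂ ++ S.dart d :: l₃) :=
    ⟨hwalk, hp.2.1.sublist (hsub.map _), fun f hf => hp.2.2 f (hsub.subset hf)⟩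
  have hS : ∀ f ∈ l₂ ++ S.dart d :: l₃, f.1 ∈ S.arcs := by
    intro f hf
    rcases List.mem_append.1 hf with hf | hf
    · exact hSa f hf
    · rcases List.mem_cons.1 hf with rfl | hf
      · exact heS
      · exact hSb f hf
  have hmem : ∀ c, c = GNode.s i ∨ c = GNode.t i → c ∈ gadgetNodes i := by
    rintro c (rfl | rfl)
    · exact s_mem_gadgetNodes.2 le_rfl
    · exact t_mem_gadgetNodes.2 le_rfl
  have hsep := h.separates hκ (hmem a ha) (hmem b hb) hwalk hS htree.2.2
  have hab : a = b := by
    rcases ha with rfl | rfl <;> rcases hb with rfl | rfl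
    · rfl
    · exact absurd (hsep.1 hκ.s_mem) hκ.t_notMem
    · exact absurd (hsep.2 hκ.s_mem) hκ.t_notMem
    · rfl
  subst hab
  have hnil : G.IsTreePath x.tree (S.node a) (S.node a) [] := ⟨rfl, by simp, by simp⟩
  have := (x.eq_treePath htree).trans (x.eq_treePath hnil).symm
  simp at this

theorem Matches.of_not_uses (h : S.Matches x X) {P : Pivot E} (hP : x.IsPivot P y)
    (hU : ¬ S.Uses x P) : S.Matches y X := by
  have hcyc : ∀ d ∈ x.cycle P.entering, d.1 ∉ S.arcs := fun d hd hS => hU ⟨d, hd, hS⟩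
  have hent : P.entering.1 ∉ S.arcs := hcyc _ List.mem_cons_self
  have hlv : P.leaving ∉ S.arcs := by
    obtain ⟨d, hd, hdl, -⟩ := hP.tight
    exact hdl ▸ hcyc d hd
  constructor
  · intro α hα
    have h₁ : S.arc α ≠ P.entering.1 := fun hh => hent (hh ▸ ⟨α, hα, rfl⟩)
    have h₂ : S.arc α ≠ P.leaving := fun hh => hlv (hh ▸ ⟨α, hα, rfl⟩)
    rw [hP.tree_eq, ← h.mem_tree α hα]
    simp [h₁, h₂]
  · intro α hα
    rw [hP.flow_eq, push_of_notMem, h.flow_eq α hα]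
    rintro d hd hdα
    exact hcyc d hd (hdα ▸ ⟨α, hα, rfl⟩)

variable {C : GadgetRun} {p : ℕ} {q : List (E × Bool)}

/-- The reduced cost of the dart of a thread from `s_i` to `t_i`. -/
theorem Matches.reducedCost_forward (h : S.Matches x X)
    (hq : G.IsTreePath x.tree (S.node (.t i)) (S.node (.s i)) q) (hqS : ∀ d ∈ q, d.1 ∉ S.arcs)
    {d : GArc × Bool} {w : List (GArc × Bool)} (hw : GadgetThread i X.tree (.s i) (.t i) d w) :
    x.reducedCost (S.dart d) = (gadgetNet v r).pathCost w + G.pathCost q := by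
  rw [reducedCost_eq_of_isThread (h.isThread hw) hq, pathCost_map_dart hw.arcs]
  intro e he f hf hef
  obtain ⟨e', he', rfl⟩ := List.mem_map.1 he
  exact hqS f hf (hef ▸ dart_mem_arcs (hw.arcs e' he'))

theorem Matches.reducedCost_backward (h : S.Matches x X)
    (hq : G.IsTreePath x.tree (S.node (.t i)) (S.node (.s i)) q) (hqS : ∀ d ∈ q, d.1 ∉ S.arcs)
    {d : GArc × Bool} {w : List (GArc × Bool)} (hw : GadgetThread i X.tree (.t i) (.s i) d w) :
    x.reducedCost (S.dart d) = (gadgetNet v r).pathCost w - G.pathCost q := by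
  have hq' : G.IsTreePath x.tree (S.node (.s i)) (S.node (.t i)) (flipWalk q) := by
    refine ⟨hq.1.flipWalk, ?_, fun d hd => hq.2.2 (flipDart d) (mem_flipWalk.1 hd)⟩
    rw [map_fst_flipWalk]
    exact List.nodup_reverse.2 hq.2.1
  rw [reducedCost_eq_of_isThread (h.isThread hw) hq', pathCost_map_dart hw.arcs,
    pathCost_flipWalk, sub_eq_add_neg]
  intro e he f hf hef
  obtain ⟨e', he', rfl⟩ := List.mem_map.1 he
  exact hqS (flipDart f) (mem_flipWalk.1 hf) (hef ▸ dart_mem_arcs (hw.arcs e' he'))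

theorem Matches.reducedCost_loop (h : S.Matches x X) {d : GArc × Bool} (hd : d.1 ∈ gadgetArcs i)
    {w : List (GArc × Bool)} (hw : (gadgetNet 0 0).IsTreePath X.tree ((gadgetNet 0 0).head d)
      ((gadgetNet 0 0).tail d) w) (hwi : ∀ e ∈ w, e.1 ∈ gadgetArcs i) :
    x.reducedCost (S.dart d) = (gadgetNet v r).dartCost d + (gadgetNet v r).pathCost w := by
  have := h.isTreePath hw hwi
  rw [← head_dart hd, ← tail_dart hd] at this
  rw [reducedCost, cycle, ← x.eq_treePath this, pathCost_cons, dartCost_dart hd,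
    pathCost_map_dart hwi]

/-- The next entering dart of the gadget is a candidate. -/
theorem Matches.isCandidate (hC : C.IsRun v r i) (h : S.Matches x (C.state p))
    (hp : p < gadgetLength i) : x.IsCandidate (S.dart (C.entering p)) := by
  have hs := hC.step p hp
  have hd := hs.arcs _ hs.mem
  refine ⟨fun hT => hs.notMem_tree ((h.mem_tree _ hd).1 hT), (h.residualGT_iff hd 0).2 ?_⟩
  by_cases hl : C.entering p = C.leaving p
  · rw [hl, hs.rescap_leaving]
    exact one_pos
  · linarith [hs.one_lt_rescap _ hs.mem hl]

/-- The gadget part costs less than 2^i, the outer path less than −2^{i+1}. -/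
theorem Matches.reducedCost_entering_lt (hC : C.IsRun v r i)
    (hB : ∑ j ∈ Finset.Icc 1 i, |v j| < 1) (h : S.Matches x (C.state p)) (hp : p < gadgetLength i)
    (hq : G.IsTreePath x.tree (S.node (.t i)) (S.node (.s i)) q) (hqS : ∀ d ∈ q, d.1 ∉ S.arcs)
    (hqc : G.pathCost q < -2 ^ (i + 1)) : x.reducedCost (S.dart (C.entering p)) < 0 := by
  rw [h.reducedCost_forward hq hqS (hC.step p hp).toGadgetThread]
  have h₁ := hC.cost_le p hp
  have h₂ : (0 : ℝ) < 2 ^ i := by positivity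
  rw [pow_succ] at hqc
  change C.cost v r p + _ < 0
  linarith

/-- An iteration that routes flow through the gadget performs the next step of the run. -/
theorem Matches.entering_eq (hC : C.IsRun v r i) (hB : ∑ j ∈ Finset.Icc 1 i, |v j| < 1)
    (h : S.Matches x (C.state p)) (hp : p ≤ gadgetLength i) {P : Pivot E} (hP : x.IsPivot P y)
    (hU : S.Uses x P)
    (hq : G.IsTreePath x.tree (S.node (.t i)) (S.node (.s i)) q) (hqS : ∀ d ∈ q, d.1 ∉ S.arcs)
    (hqc : G.pathCost q < -2 ^ (i + 1)) :
    p < gadgetLength i ∧ P.entering = S.dart (C.entering p) := by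
  obtain ⟨κ, hκ⟩ := hC.separates p hp
  -- An entering arc outside the gadget has no inner end node, so its cycle would avoid the gadget.
  have hent : P.entering.1 ∈ S.arcs := by
    by_contra hne
    obtain ⟨d, hd, hdS⟩ := hU
    rcases List.mem_cons.1 hd with rfl | hd
    · exact hne hdS
    · exact h.notMem_arcs hκ (head_notMem_inner hne) (tail_notMem_inner hne)
        (x.isTreePath_treePath _ _) d hd hdS
  obtain ⟨δ, hδ, hδe⟩ := exists_dart_eq hent
  have hcand := hP.candidate
  have himp := hP.improving
  rw [← hδe] at hcand himp
  have hpow : (0 : ℝ) < 2 ^ i := by positivity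
  rcases hC.classified p hp δ hδ (fun hT => hcand.1 ((h.mem_tree _ hδ).2 hT))
    ((h.residualGT_iff hδ 0).1 hcand.2) with ⟨w, hw, hp', hwc⟩ | ⟨w, hw, hp', hwc⟩ |
    ⟨w, hw, hwi, hwc⟩
  · refine ⟨hp', ?_⟩
    rw [← hδe]
    rcases hwc with ⟨rfl, -⟩ | hwc
    · rfl
    · have hd := hP.dantzig _ (h.isCandidate hC hp')
      rw [← hδe, h.reducedCost_forward hq hqS hw,
        h.reducedCost_forward hq hqS (hC.step p hp').toGadgetThread] at hd
      change _ ≤ C.cost v r p + _ at hd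
      linarith
  -- A backward crossing costs more than −2^i, and traversing the outer path backwards costs more
  -- than 2^{i+1}.
  · exfalso
    rw [h.reducedCost_backward hq hqS hw] at himp
    have h₁ := hC.cost_le (p - 1) (by omega)
    rw [pow_succ] at hqc
    rcases hwc with ⟨-, hwc⟩ | hwc <;> linarith
  · exfalso
    rw [h.reducedCost_loop hδ hw hwi] at himp
    linarith

/-- All residual capacities on the cycle exceed 1, except that of the prescribed leaving dart, which
is 1. This forces the amount and the leaving arc, whatever the tie-breaking. -/
theorem Matches.step (hC : C.IsRun v r i) (hB : ∑ j ∈ Finset.Icc 1 i, |v j| < 1)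
    (h : S.Matches x (C.state p)) (hp : p ≤ gadgetLength i) {P : Pivot E} (hP : x.IsPivot P y)
    (hU : S.Uses x P) (hcheap : S.CheapPath x) :
    p < gadgetLength i ∧ P.entering.1 = S.arc (C.entering p).1 ∧
      P.leaving = S.arc (C.leaving p).1 ∧ S.RoutesUnit x P ∧
      S.incurredCost x P = C.cost v r p ∧ S.Matches y (C.state (p + 1)) := by
  obtain ⟨q, hq, hqc, hqr⟩ := hcheap
  obtain ⟨κ, hκ⟩ := hC.separates p hp
  have hqS := h.notMem_arcs hκ node_t_notMem_inner node_s_notMem_inner hq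
  obtain ⟨hp', hent⟩ := h.entering_eq hC hB hp hP hU hq hqS hqc
  have hs := hC.step p hp'
  have hwS : ∀ d ∈ (C.walk p).map S.dart, d.1 ∈ S.arcs := by
    intro d hd
    obtain ⟨e, he, rfl⟩ := List.mem_map.1 hd
    exact dart_mem_arcs (hs.arcs e he)
  obtain ⟨p₁, p₂, hw, hcyc⟩ := cycle_eq_of_isThread (h.isThread hs.toGadgetThread) hq
    fun e he f hf hef => hqS f hf (hef ▸ hwS e he)
  rw [← hent] at hcyc
  have hmem : ∀ d, d ∈ x.cycle P.entering ↔ d ∈ (C.walk p).map S.dart ∨ d ∈ q := by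
    intro d
    rw [hcyc, hw, hent]
    simp only [List.mem_cons, List.mem_append]
    tauto
  have hl := hs.arcs _ hs.leaving_mem
  have hlc : S.dart (C.leaving p) ∈ x.cycle P.entering :=
    (hmem _).2 (Or.inl (List.mem_map.2 ⟨_, hs.leaving_mem, rfl⟩))
  have hle : P.amount ≤ 1 := by
    have hf := flow_of_mem_cycle hP hlc
    have hres := hs.rescap_leaving
    have hxf := h.flow_eq _ hl
    have h₀ := y.nonneg (S.arc (C.leaving p).1)
    have h₁ := y.le_cap (S.arc (C.leaving p).1)
    rw [S.cap_eq _ hl, WithTop.coe_le_coe] at h₁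
    generalize C.leaving p = l at *
    rcases l with ⟨α, _ | _⟩ <;> simp only [dart, rescap] at * <;> simp at hf <;> linarith
  have hgt : ∀ d ∈ x.cycle P.entering, d ≠ S.dart (C.leaving p) → G.ResidualGT x.flow 1 d := by
    intro d hd hne
    rcases (hmem d).1 hd with hd | hd
    · obtain ⟨e, he, rfl⟩ := List.mem_map.1 hd
      refine (h.residualGT_iff (hs.arcs e he) 1).2 (hs.one_lt_rescap e he ?_)
      rintro rfl
      exact hne rfl
    · exact hqr d hd
  obtain ⟨d, hd, hdl, hdr⟩ := hP.tight
  obtain rfl : d = S.dart (C.leaving p) := by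
    by_contra hne
    exact hdr (residual_of_residualGT hP hd hle (hgt d hd hne))
  have hamount : P.amount = 1 := by
    refine le_antisymm hle (le_of_not_gt fun hlt => hdr ?_)
    -- If less than 1 were sent, the midpoint between the amount and 1 would witness that the
    -- leaving dart is not tight.
    have hlt' : P.amount ≤ (P.amount + 1) / 2 := by linarith
    refine residual_of_residualGT hP hd hlt' ((h.residualGT_iff hl _).2 ?_)
    rw [hs.rescap_leaving]
    linarith
  refine ⟨hp', by rw [hent]; rfl, hdl.symm, ⟨hamount, _, q, ?_, isWalk_map_dart hs.arcs hs.walk,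
    hwS, hq, hqS⟩, ?_, ⟨?_, ?_⟩⟩
  · rw [hw, hcyc, hent]
    have := List.isRotated_append (l := p₁) (l' := S.dart (C.entering p) :: (p₂ ++ q))
    simpa using this
  · have hp₁ : ∀ d ∈ p₁, d.1 ∈ S.arcs := fun d hd => hwS d (by simp [hw, hd])
    have hp₂ : ∀ d ∈ p₂, d.1 ∈ S.arcs := fun d hd => hwS d (by simp [hw, hd])
    have hd : P.entering.1 ∈ S.arcs := by
      rw [hent]
      exact dart_mem_arcs (hs.arcs _ hs.mem)
    rw [incurredCost, hamount, one_mul, GadgetRun.cost, ← pathCost_map_dart hs.arcs, hw, hcyc,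
      List.filter_cons_of_pos (by simpa using hd), List.filter_append, List.filter_append,
      List.filter_eq_self.2 (by simpa using hp₂), List.filter_eq_nil_iff.2 (by simpa using hqS),
      List.filter_eq_self.2 (by simpa using hp₁), hent]
    simp only [pathCost_append, pathCost_cons, pathCost_nil]
    ring
  · intro α hα
    rw [hs.tree_eq α hα, hP.tree_eq, hent, ← hdl]
    have h₁ : S.arc α = (S.dart (C.entering p)).1 ↔ α = (C.entering p).1 :=
      S.arc_injOn.eq_iff hα (hs.arcs _ hs.mem)
    have h₂ : S.arc α = (S.dart (C.leaving p)).1 ↔ α = (C.leaving p).1 :=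
      S.arc_injOn.eq_iff hα hl
    simp [h₁, h₂, h.mem_tree α hα]
  · intro α hα
    rw [hs.flow_eq α hα, hP.flow_eq, hamount]
    refine push_congr (h.flow_eq α hα) fun b => ?_
    rw [hmem]
    constructor
    · rintro (hb | hb)
      · obtain ⟨e, he, heb⟩ := List.mem_map.1 hb
        rwa [← dart_inj (S := S) (e := (α, b)) (hs.arcs e he) hα heb]
      · exact absurd ⟨α, hα, rfl⟩ (hqS _ hb)
    · exact fun hb => Or.inl (List.mem_map.2 ⟨_, hb, rfl⟩)

/-- Before the end of the run the next entering dart is a candidate of negative reduced cost. -/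
theorem Matches.length_le_of_isOptimal (hC : C.IsRun v r i)
    (hB : ∑ j ∈ Finset.Icc 1 i, |v j| < 1) (h : S.Matches x (C.state p)) (hopt : x.IsOptimal)
    (hcheap : S.CheapPath x) : gadgetLength i ≤ p := by
  by_contra hp
  obtain ⟨q, hq, hqc, hqr⟩ := hcheap
  obtain ⟨κ, hκ⟩ := hC.separates p (by omega)
  have hqS := h.notMem_arcs hκ node_t_notMem_inner node_s_notMem_inner hq
  have := h.reducedCost_entering_lt hC hB (by omega) hq hqS hqc
  linarith [hopt _ (h.isCandidate hC (by omega))]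

theorem IsInitial.matches (h : S.IsInitial x) (hC : C.IsRun v r i) :
    S.Matches x (C.state 0) := by
  constructor
  · intro α hα
    rw [h.mem_tree α hα, hC.init_tree α hα]
  · intro α hα
    obtain ⟨h₁, h₂⟩ := hC.init_flow α hα
    rw [hC.init_tree α hα] at h₁ h₂
    by_cases hj : ∃ j, α = .ss j ∨ α = .tt j
    · rw [h.flow_path α hα hj, h₁ hj]
    · rw [h.flow_other α hα hj, h₂ hj]

end Gadget

end

/-! ### Executions of the algorithm -/

theorem lemma3 {V E : Type*} [Fintype E] (G : Network V E)
    (n i : ℕ) (hi : i ≤ n)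
    (a : ℕ → ℝ) (ha : ∀ j ∈ Finset.Icc 1 n, 0 ≤ a j)
    (A : ℝ) (hA : A = ∑ j ∈ Finset.Icc 1 n, a j) (hA' : A < 1 / 12)
    (v : ℕ → ℝ) (hv : v = a ∨ v = -a)
    (r : ℝ) (hr : r ∈ Set.Ioo (2 * A) (1 - 2 * A)) (hr' : r ≠ 1 / 2)
    (S : Gadget G v r i)
    -- the first `N` iterations of an execution of the Network Simplex Algorithm on `G`
    (N : ℕ) (σ : ℕ → G.BasicSolution) (P : ℕ → Network.Pivot E)
    (hinit : S.IsInitial (σ 0))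
    (hstep : ∀ m < N, (σ m).IsPivot (P m) (σ (m + 1)))
    (hpath : ∀ m < N, S.Uses (σ m) (P m) → S.CheapPath (σ m)) :
    -- `τ 0 < τ 1 < ⋯ < τ (M - 1)` are the iterations in which flow is routed through the gadget
    ∃ (M : ℕ) (τ : ℕ → ℕ),
      StrictMonoOn τ (Set.Iio M) ∧
      (∀ m, (m < N ∧ S.Uses (σ m) (P m)) ↔ ∃ j < M, τ j = m) ∧
      (∀ j < M, S.RoutesUnit (σ (τ j)) (P (τ j))) ∧
      -- there are never more than `3 * 2 ^ i - 2` of them, and exactly that many on termination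
      M ≤ 3 * 2 ^ i - 2 ∧
      ((σ N).IsOptimal → (M < 3 * 2 ^ i - 2 → S.CheapPath (σ N)) → M = 3 * 2 ^ i - 2) ∧
      -- iterations `3 * k`
      (∀ k < 2 ^ i, 3 * k < M →
        (P (τ (3 * k))).entering.1 = S.arc .base ∧
        (P (τ (3 * k))).leaving = S.arc .base ∧
        (σ (τ (3 * k))).flow (S.arc .base) = ((k % 2 : ℕ) : ℝ) ∧
        (σ (τ (3 * k) + 1)).flow (S.arc .base) = (((k + 1) % 2 : ℕ) : ℝ) ∧
        S.incurredCost (σ (τ (3 * k))) (P (τ (3 * k))) = k + signedSum v 0 i k) ∧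
      -- iterations `3 * k + 1` and `3 * k + 2`
      (∀ k < 2 ^ i - 1, ∃ i' ∈ Set.Icc 1 i,
        (3 * k + 1 < M →
          S.incurredCost (σ (τ (3 * k + 1))) (P (τ (3 * k + 1)))
            = k + min r (1 - r) + signedSum v i' i k) ∧
        (3 * k + 2 < M →
          S.incurredCost (σ (τ (3 * k + 2))) (P (τ (3 * k + 2)))
            = k + max r (1 - r) + signedSum v i' i k) ∧
        (((3 * k + 1 < M → S.Swaps (P (τ (3 * k + 1))) (.ss i') (.ts i')) ∧
          (3 * k + 2 < M → S.Swaps (P (τ (3 * k + 2))) (.st i') (.tt i'))) ∨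
         ((3 * k + 1 < M → S.Swaps (P (τ (3 * k + 1))) (.st i') (.tt i')) ∧
          (3 * k + 2 < M → S.Swaps (P (τ (3 * k + 2))) (.ss i') (.ts i'))))) := by
  classical
  have hB : ∑ j ∈ Finset.Icc 1 i, |v j| ≤ A := by
    rw [hA]
    have habs : ∀ j ∈ Finset.Icc 1 n, |v j| = a j := by
      intro j hj
      rcases hv with rfl | rfl
      · exact abs_of_nonneg (ha j hj)
      · rw [Pi.neg_apply, abs_neg, abs_of_nonneg (ha j hj)]
    calc ∑ j ∈ Finset.Icc 1 i, |v j| ≤ ∑ j ∈ Finset.Icc 1 n, |v j| :=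
          Finset.sum_le_sum_of_subset_of_nonneg (Finset.Icc_subset_Icc_right hi)
            fun _ _ _ => abs_nonneg _
      _ = ∑ j ∈ Finset.Icc 1 n, a j := Finset.sum_congr rfl habs
  have hA₀ : 0 ≤ A := hA ▸ Finset.sum_nonneg ha
  have hr₁ := hr.1
  have hr₂ := hr.2
  obtain ⟨C, hC⟩ := exists_isRun v r i (by linarith) (by linarith) hr'
  have hB₁ : ∑ j ∈ Finset.Icc 1 i, |v j| < 1 := by linarith
  -- The bound `m < N` makes `U` finite, so `Nat.nth U` enumerates exactly the first `Nat.count U N`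
  -- indices without default values.
  let U : ℕ → Prop := fun m => m < N ∧ S.Uses (σ m) (P m)
  -- The state of the gadget depends only on how many earlier iterations have used it.
  have hmatch : ∀ m ≤ N, Nat.count U m ≤ gadgetLength i ∧
      S.Matches (σ m) (C.state (Nat.count U m)) := by
    intro m
    induction m with
    | zero => exact fun _ => ⟨by simp, by simpa using hinit.matches hC⟩
    | succ m ih =>
      intro hm
      obtain ⟨h₁, h₂⟩ := ih (by omega)
      have hm' : m < N := by omega
      rw [Nat.count_succ]
      by_cases hU : U m
      · obtain ⟨h₃, -, -, -, -, h₄⟩ := h₂.step hC hB₁ h₁ (hstep m hm') hU.2 (hpath m hm' hU.2)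
        rw [if_pos hU]
        exact ⟨h₃, h₄⟩
      · rw [if_neg hU]
        exact ⟨h₁, h₂.of_not_uses (hstep m hm') fun h => hU ⟨hm', h⟩⟩
  have hfin : (Set.ofPred U).Finite := (Set.finite_Iio N).subset fun m hm => hm.1
  have hcard : hfin.toFinset.card = Nat.count U N := by
    rw [Nat.count_eq_card_filter_range]
    congr 1
    ext m
    simp only [Set.Finite.mem_toFinset, Set.mem_ofPred_eq, Finset.mem_filter, Finset.mem_range]
    exact ⟨fun h => ⟨h.1, h⟩, fun h => h.2⟩
  have hstepU : ∀ j < Nat.count U N, j < gadgetLength i ∧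
      (P (Nat.nth U j)).entering.1 = S.arc (C.entering j).1 ∧
      (P (Nat.nth U j)).leaving = S.arc (C.leaving j).1 ∧
      S.RoutesUnit (σ (Nat.nth U j)) (P (Nat.nth U j)) ∧
      S.incurredCost (σ (Nat.nth U j)) (P (Nat.nth U j)) = C.cost v r j ∧
      S.Matches (σ (Nat.nth U j)) (C.state j) ∧
      S.Matches (σ (Nat.nth U j + 1)) (C.state (j + 1)) := by
    intro j hj
    have hU : U (Nat.nth U j) := Nat.nth_mem j fun h => by rwa [hcard]
    have hcount : Nat.count U (Nat.nth U j) = j := Nat.count_nth fun h => by rwa [hcard]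
    obtain ⟨h₁, h₂⟩ := hmatch _ hU.1.le
    rw [hcount] at h₁ h₂
    obtain ⟨g₁, g₂, g₃, g₄, g₅, g₆⟩ :=
      h₂.step hC hB₁ h₁ (hstep _ hU.1) hU.2 (hpath _ hU.1 hU.2)
    exact ⟨g₁, g₂, g₃, g₄, g₅, h₂, g₆⟩
  have hswaps : ∀ j < Nat.count U N, ∀ α β, C.Swaps j α β →
      S.Swaps (P (Nat.nth U j)) α β := by
    intro j hj α β h
    obtain ⟨-, h₁, h₂, -⟩ := hstepU j hj
    rw [Gadget.Swaps, h₁, h₂]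
    rcases h with ⟨h₃, h₄⟩ | ⟨h₃, h₄⟩
    · exact Or.inl ⟨by rw [h₃], by rw [h₄]⟩
    · exact Or.inr ⟨by rw [h₃], by rw [h₄]⟩
  obtain ⟨hN₁, hN₂⟩ := hmatch N le_rfl
  refine ⟨Nat.count U N, Nat.nth U, ?_, ?_, fun j hj => (hstepU j hj).2.2.2.1, hN₁, ?_, ?_, ?_⟩
  · rw [← hcard]
    exact Nat.nth_strictMonoOn hfin
  · intro m
    constructor
    · intro hm
      exact ⟨Nat.count U m, Nat.count_strict_mono (p := U) hm hm.1, Nat.nth_count hm⟩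
    · rintro ⟨j, hj, rfl⟩
      exact Nat.nth_mem (p := U) j fun h => by rwa [hcard]
  · intro hopt hcheap
    refine le_antisymm hN₁ (le_of_not_gt fun hlt => ?_)
    exact absurd (hN₂.length_le_of_isOptimal hC hB₁ hopt (hcheap hlt)) (not_le.2 hlt)
  · intro k hk hkM
    obtain ⟨h₁, h₂, h₃, h₄, h₅⟩ := hC.base_step k hk
    obtain ⟨-, g₂, g₃, -, g₅, g₆, g₇⟩ := hstepU (3 * k) hkM
    have hbase := base_mem_gadgetArcs i
    exact ⟨by rw [g₂, h₁], by rw [g₃, h₂], by rw [g₆.flow_eq _ hbase, h₃],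
      by rw [g₇.flow_eq _ hbase, h₄], by rw [g₅, h₅]⟩
  · intro k hk
    obtain ⟨i', hi', -, h₁, h₂, h₃⟩ := hC.level_step k (by omega)
    refine ⟨i', hi', ?_, ?_, ?_⟩
    · intro hM
      rw [(hstepU _ hM).2.2.2.2.1, h₁]
    · intro hM
      rw [(hstepU _ hM).2.2.2.2.1, h₂]
    · rcases h₃ with ⟨h₃, h₄⟩ | ⟨h₃, h₄⟩
      · exact Or.inl ⟨fun hM => hswaps _ hM _ _ h₃, fun hM => hswaps _ hM _ _ h₄⟩
      · exact Or.inr ⟨fun hM => hswaps _ hM _ _ h₃, fun hM => hswaps _ hM _ _ h₄⟩
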